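/- Let $n\ge 1$ and let $F^2(H_n)=\bigoplus_{k\ge 0}H_n^{\otimes k}$ be the full Fock space over an $n$-dimensional complex Hilbert space $H_n$ with orthonormal basis $e_1,\dots,e_n$. For a word $\alpha=g_{i_1}\cdots g_{i_k}$ in the free semigroup $\mathbb F_n^+$ put $|\alpha|=k$, $e_\alpha=e_{i_1}\otimes\cdots\otimes e_{i_k}$ ($e_{g_0}=1$ for the empty word $g_0$), and for operators $T_1,\dots,T_n$ put $T_\alpha=T_{i_1}\cdots T_{i_k}$ ($T_{g_0}=I$). Let $S_i\varphi=e_i\otimes\varphi$ be the left creation operators on $F^2(H_n)$, and let $F_n^\infty$ be the WOT-closed algebra generated by $S_1,\dots,S_n$ and $I$. For $f\in F_n^\infty$ write $f1=\sum_\alpha a_\alpha e_\alpha$, and for bounded operators $T_1,\dots,T_n$ put $$f(T_1,\dots,T_n):=\text{SOT-}\lim_{r\to1^-}\sum_{k=0}^\infty\sum_{|\alpha|=k}r^{k}a_\alpha T_\alpha,$$ where it is part of the assertion that $f(T_1,\dots,T_n)$ exists that for $0<r<1$ the series in $k$ converges in norm and that the SOT-limit exists. Let $J\ne F_n^\infty$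 be a WOT-closed two-sided ideal of $F_n^\infty$, let $\mathcal M_J$ be the closed linear span of $JF^2(H_n)$, $\mathcal N_J=F^2(H_n)\ominus\mathcal M_J$, $B_i=P_{\mathcal N_J}S_i|_{\mathcal N_J}$, and let $\mathcal W(B_1,\dots,B_n)$ be the $w^*$-closed algebra generated by $B_1,\dots,B_n$ and the identity of $\mathcal N_J$. Let $T=[T_1,\dots,T_n]$, $T_i\in B(\mathcal H)$, be a row contraction on a complex Hilbert space $\mathcal H$ (that is, $\sum_iT_iT_i^*\le I$) which is completely non-coisometric: there is no $h\ne0$ in $\mathcal H$ with $\sum_{|\alpha|=k}\|T_\alpha^*h\|^2=\|h\|^2$ for all $k\ge1$. Assume that $\varphi(T_1,\dots,T_n)=0$ for all $\varphi\in J$. Let $\Delta_T=(I-\sum_iT_iT_i^*)^{1/2}$, and let $$K_{J,T}:\mathcal H\to\mathcal N_J\otimes\overline{\Delta_T\mathcal H},\qquad K_{J,T}h=(P_{\mathcal N_J}\otimes I)\sum_{\alpha\in\mathbb F_n^+}e_\alpha\otimes\Delta_TT_\alpha^*h .$$ Then: 1. $K_{J,T}T_i^*=(B_i^*\otimes I_{\overline{\Delta_T\mathcal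 H}})K_{J,T}$ for $i=1,\dots,n$. 2. The limit $\text{SOT-}\lim_{k\to\infty}\sum_{|\alpha|=k}T_\alpha T_\alpha^*$ exists, and $K_{J,T}^*K_{J,T}=I_{\mathcal H}-\text{SOT-}\lim_{k\to\infty}\sum_{|\alpha|=k}T_\alpha T_\alpha^*$. Moreover, $K_{J,T}$ is injective. 3. If a map $\Psi:\mathcal W(B_1,\dots,B_n)\to B(\mathcal H)$ (not assumed linear or continuous) satisfies $$\Psi(X)K_{J,T}^*=K_{J,T}^*(X\otimes I_{\overline{\Delta_T\mathcal H}}),\qquad X\in\mathcal W(B_1,\dots,B_n),$$ then $\Psi(f(B_1,\dots,B_n))=f(T_1,\dots,T_n)$ for every element $f(B_1,\dots,B_n)$ of $\mathcal W(B_1,\dots,B_n)$. That is, every $X\in\mathcal W(B_1,\dots,B_n)$ has the form $X=f(B_1,\dots,B_n)$ for some $f\in F_n^\infty$, and for every such $f$ the operator $f(T_1,\dots,T_n)$ exists and equals $\Psi(X)$. -/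

import Mathlib

open Filter Topology
open scoped TensorProduct InnerProductSpace ENNReal

noncomputable section

namespace NCVariety

/-! ### Hilbert space tensor products -/

/-- The Hilbert space tensor product: the completion of the algebraic tensor product with respect
to `⟪x ⊗ y, x' ⊗ y'⟫ = ⟪x, x'⟫ * ⟪y, y'⟫`. -/
abbrev HilbertTensor (E D : Type*) [NormedAddCommGroup E] [InnerProductSpace ℂ E]
    [NormedAddCommGroup D] [InnerProductSpace ℂ D] : Type _ :=
  UniformSpace.Completion (E ⊗[ℂ] D)

section Tensor

variable {E E' D : Type*} [NormedAddCommGroup E] [InnerProductSpace ℂ E]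
  [NormedAddCommGroup E'] [InnerProductSpace ℂ E'] [NormedAddCommGroup D] [InnerProductSpace ℂ D]

/-- The elementary tensor `x ⊗ y` in the Hilbert space tensor product. -/
def tmulH (x : E) (y : D) : HilbertTensor E D := ((x ⊗ₜ[ℂ] y : E ⊗[ℂ] D) : HilbertTensor E D)

/-- The bounded operator `A ⊗ I_D`, the extension by continuity of `x ⊗ y ↦ A x ⊗ y`. -/
def tensorId (D : Type*) [NormedAddCommGroup D] [InnerProductSpace ℂ D] (A : E →L[ℂ] E') :
    HilbertTensor E D →L[ℂ] HilbertTensor E' D :=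
  (A.rTensor D).completion

theorem tensorId_tmulH (A : E →L[ℂ] E') (x : E) (y : D) :
    tensorId D A (tmulH x y) = tmulH (A x) y := by
  simp only [tensorId, tmulH]
  exact ContinuousLinearMap.completion_apply_coe _ _

end Tensor

/-! ### Operator topologies -/

section Topologies

variable {E : Type*} [NormedAddCommGroup E] [InnerProductSpace ℂ E]

/-- A set of operators is closed in the weak operator topology. -/
def IsWOTClosed (s : Set (E →L[ℂ] E)) : Prop :=
  IsClosed ((ContinuousLinearMapWOT.toCLM : (E →WOT[ℂ] E) → (E →L[ℂ] E)) ⁻¹' s)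

variable (E) in
/-- The `w^*`-topology (ultraweak topology) of `B(E)`: the coarsest topology that makes all
functionals `A ↦ ∑ j, ⟪y j, A (x j)⟫` continuous, where `x` and `y` are square-summable
sequences of vectors. -/
abbrev weakStarTopology : TopologicalSpace (E →L[ℂ] E) :=
  ⨅ (x : lp (fun _ : ℕ => E) 2) (y : lp (fun _ : ℕ => E) 2),
    TopologicalSpace.induced (fun A : E →L[ℂ] E => ∑' j, ⟪y j, A (x j)⟫_ℂ) inferInstance

/-- A set of operators is closed in the `w^*`-topology of `B(E)`. -/
def IsWeakStarClosed (s : Set (E →L[ℂ] E)) : Prop :=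
  IsClosed[weakStarTopology E] s

/-- The operators `A i` converge to `Q` along `l` in the strong operator topology. -/
def TendstoSOT {ι : Type*} (A : ι → E →L[ℂ] E) (l : Filter ι) (Q : E →L[ℂ] E) : Prop :=
  ∀ h : E, Tendsto (fun i => A i h) l (𝓝 (Q h))

end Topologies

/-! ### The full Fock space, the creation operators, and the noncommutative analytic Toeplitz
algebra -/

/-- The full Fock space `F²(Hₙ)`, as `ℓ²` of the free semigroup on `n` generators; a word
`α = [i₁, …, iₖ]` labels the orthonormal basis vector `e_α = e_{i₁} ⊗ ⋯ ⊗ e_{iₖ}` of the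
summand `Hₙ^{⊗ k}`. -/
abbrev Fock (n : ℕ) : Type := lp (fun _ : List (Fin n) => ℂ) 2

/-- The orthonormal basis vector `e_α`; in particular `fockBasis []` is the vacuum vector `1`. -/
def fockBasis {n : ℕ} (α : List (Fin n)) : Fock n := lp.single 2 α (1 : ℂ)

/-- The coordinates of `eᵢ ⊗ φ`, where `φ` is given by its coordinates. -/
def prependCoord {n : ℕ} (i : Fin n) (φ : List (Fin n) → ℂ) : List (Fin n) → ℂ
  | [] => 0
  | j :: β => if j = i then φ β else 0

theorem prependCoord_norm_sq {n : ℕ} (i : Fin n) (φ : List (Fin n) → ℂ) :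
    (fun α => ‖prependCoord i φ α‖ ^ 2)
      = Function.extend (List.cons i) (fun β => ‖φ β‖ ^ 2) 0 := by
  have hinj : Function.Injective (List.cons i) := List.cons_injective
  funext α
  cases α with
  | nil =>
    rw [Function.extend_apply']
    · simp [prependCoord]
    · rintro ⟨β, hβ⟩
      exact absurd hβ (by simp)
  | cons j β =>
    by_cases hj : j = i
    · subst hj
      rw [hinj.extend_apply]
      simp [prependCoord]
    · rw [Function.extend_apply']
      · simp [prependCoord, hj]
      · rintro ⟨γ, hγ⟩
        exact hj (by simpa using (List.cons.inj hγ).1.symm)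

theorem prependCoord_hasSum {n : ℕ} (i : Fin n) (φ : Fock n) :
    HasSum (fun α => ‖prependCoord i φ α‖ ^ 2) (‖φ‖ ^ 2) := by
  have h : HasSum (fun β => ‖φ β‖ ^ 2) (‖φ‖ ^ 2) := by
    have := lp.hasSum_norm (p := 2) (by norm_num) φ
    simpa using this
  rw [prependCoord_norm_sq]
  exact (hasSum_extend_zero List.cons_injective).2 h

theorem prependCoord_memℓp {n : ℕ} (i : Fin n) (φ : Fock n) :
    Memℓp (E := fun _ : List (Fin n) => ℂ) (prependCoord i φ) 2 := by
  refine memℓp_gen ?_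
  simpa using (prependCoord_hasSum i φ).summable

/-- The left creation operator `Sᵢ φ = eᵢ ⊗ φ` on the full Fock space. -/
def leftCreation {n : ℕ} (i : Fin n) : Fock n →L[ℂ] Fock n :=
  LinearMap.mkContinuous
    { toFun := fun φ => (⟨prependCoord i φ, prependCoord_memℓp i φ⟩ : Fock n)
      map_add' := by
        intro φ ψ
        ext α
        cases α with
        | nil => exact (add_zero (0 : ℂ)).symm
        | cons j β =>
          change prependCoord i (⇑(φ + ψ)) (j :: β) =
            prependCoord i (⇑φ) (j :: β) + prependCoord i (⇑ψ) (j :: β)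
          by_cases hj : j = i <;> simp [prependCoord, hj]
      map_smul' := by
        intro c φ
        ext α
        cases α with
        | nil => simp [prependCoord]
        | cons j β => by_cases hj : j = i <;> simp [prependCoord, hj] }
    1 (by
      intro φ
      rw [one_mul]
      have h1 := prependCoord_hasSum i φ
      have h2 := lp.hasSum_norm (p := 2) (by norm_num)
        (⟨prependCoord i φ, prependCoord_memℓp i φ⟩ : Fock n)
      have h3 : HasSum (fun α => ‖prependCoord i φ α‖ ^ 2)
          (‖(⟨prependCoord i φ, prependCoord_memℓp i φ⟩ : Fock n)‖ ^ 2) := by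
        simpa using h2
      exact le_of_eq ((sq_eq_sq₀ (norm_nonneg _) (norm_nonneg _)).1 (h3.unique h1)))

/-- The noncommutative analytic Toeplitz algebra `Fₙ^∞`: the WOT-closed algebra generated by the
left creation operators and the identity. -/
def toeplitzAlgebra (n : ℕ) : Subalgebra ℂ (Fock n →L[ℂ] Fock n) :=
  sInf {A | (∀ i, leftCreation i ∈ A) ∧ IsWOTClosed (A : Set (Fock n →L[ℂ] Fock n))}

/-- The Fourier coefficient `a_α` of `f = ∑ a_α S_α`, that is, the `α`-th coordinate of `f 1`. -/
def fourierCoeff {n : ℕ} (f : Fock n →L[ℂ] Fock n) (α : List (Fin n)) : ℂ :=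
  f (fockBasis []) α

/-! ### Row contractions and the functional calculus -/

section RowContraction

variable {n : ℕ} {H : Type*} [NormedAddCommGroup H] [InnerProductSpace ℂ H]

/-- `T_α = T_{i₁} ⋯ T_{iₖ}` for the word `α = [i₁, …, iₖ]`, and `T_∅ = I`. -/
def wordOp (T : Fin n → H →L[ℂ] H) (α : List (Fin n)) : H →L[ℂ] H := (α.map T).prod

/-- The `k`-th term `∑_{|α| = k} r^k a_α T_α` of the series for `f(rT)`, where `a_α` are the Fourier coefficients of `f`. The words of
length `k` are the lists `List.ofFn α` with `α : Fin k → Fin n`. -/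
def radialTerm (T : Fin n → H →L[ℂ] H) (f : Fock n →L[ℂ] Fock n) (r : ℝ) (k : ℕ) : H →L[ℂ] H :=
  ∑ α : Fin k → Fin n,
    ((r : ℂ) ^ k * fourierCoeff f (List.ofFn α)) • wordOp T (List.ofFn α)

/-- `f(T₁, …, Tₙ)` exists and equals `A`: for `0 < r < 1` the series
`f(rT) = ∑ₖ ∑_{|α| = k} r^k a_α T_α` converges in norm, and `f(rT) → A` in the strong operator
topology as `r → 1`. -/
def HasFunctionalCalculus (T : Fin n → H →L[ℂ] H) (f : Fock n →L[ℂ] Fock n)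
    (A : H →L[ℂ] H) : Prop :=
  (∀ r ∈ Set.Ioo (0 : ℝ) 1, Summable (radialTerm T f r)) ∧
    TendstoSOT (fun r : ℝ => ∑' k, radialTerm T f r k) (𝓝[<] 1) A

variable [CompleteSpace H]

/-- `T₁T₁* + ⋯ + TₙTₙ* ≤ I`. -/
def IsRowContraction (T : Fin n → H →L[ℂ] H) : Prop :=
  ∑ i, T i ∘L (T i).adjoint ≤ 1

/-- Complete non-coisometry: there is no `h ≠ 0` with `∑_{|α| = k} ‖T_α* h‖² = ‖h‖²` for all
`k = 1, 2, …`. -/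
def IsCNC (T : Fin n → H →L[ℂ] H) : Prop :=
  ¬ ∃ h : H, h ≠ 0 ∧ ∀ k : ℕ, 1 ≤ k →
    ∑ α : Fin k → Fin n, ‖(wordOp T (List.ofFn α)).adjoint h‖ ^ 2 = ‖h‖ ^ 2

/-- The defect operator `Δ_T = (I - T₁T₁* - ⋯ - TₙTₙ*)^{1/2}`. -/
def defect (T : Fin n → H →L[ℂ] H) : H →L[ℂ] H :=
  CFC.sqrt (1 - ∑ i, T i ∘L (T i).adjoint)

/-- The defect space, the closure of `Δ_T H`. -/
def defectSpace (T : Fin n → H →L[ℂ] H) : Submodule ℂ H :=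
  (LinearMap.range (defect T : H →ₗ[ℂ] H)).topologicalClosure

/-- `Δ_T h` as a vector of the defect space. -/
def defectVec (T : Fin n → H →L[ℂ] H) (h : H) : defectSpace T :=
  ⟨defect T h, Submodule.le_topologicalClosure _ ⟨h, rfl⟩⟩

/-! ### The Poisson kernel -/

theorem norm_sq_defect {T : Fin n → H →L[ℂ] H} (hT : IsRowContraction T) (h : H) :
    ‖defectVec T h‖ ^ 2 + ∑ i, ‖(T i).adjoint h‖ ^ 2 = ‖h‖ ^ 2 := by
  have hpos : (0 : H →L[ℂ] H) ≤ 1 - ∑ i, T i ∘L (T i).adjoint := sub_nonneg.2 hT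
  have hsq : defect T * defect T = 1 - ∑ i, T i ∘L (T i).adjoint := CFC.sqrt_mul_sqrt_self _ hpos
  have hsa : IsSelfAdjoint (defect T) := IsSelfAdjoint.of_nonneg (CFC.sqrt_nonneg _)
  have hadj : (defect T).adjoint = defect T := hsa
  have e1 : (‖defect T h‖ : ℂ) ^ 2 = (‖h‖ : ℂ) ^ 2 - ∑ i, (‖(T i).adjoint h‖ : ℂ) ^ 2 := by
    have e4 : ⟪h, (defect T * defect T) h⟫_ℂ = (‖defect T h‖ : ℂ) ^ 2 := by
      change ⟪h, defect T (defect T h)⟫_ℂ = _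
      rw [← ContinuousLinearMap.adjoint_inner_left, hadj]
      exact inner_self_eq_norm_sq_to_K _
    have e5 : ∀ i, ⟪h, T i ((T i).adjoint h)⟫_ℂ = (‖(T i).adjoint h‖ : ℂ) ^ 2 := by
      intro i
      rw [← ContinuousLinearMap.adjoint_inner_left]
      exact inner_self_eq_norm_sq_to_K _
    have e6 : ⟪h, h⟫_ℂ = (‖h‖ : ℂ) ^ 2 := inner_self_eq_norm_sq_to_K _
    rw [← e4, hsq, ← e6, _root_.sub_apply, inner_sub_right,
      _root_.sum_apply, inner_sum]
    exact congrArg (fun z => ⟪h, h⟫_ℂ - z) (Finset.sum_congr rfl fun i _ => e5 i)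
  have e2 : ‖defectVec T h‖ = ‖defect T h‖ := rfl
  have e3 : ‖defect T h‖ ^ 2 = ‖h‖ ^ 2 - ∑ i, ‖(T i).adjoint h‖ ^ 2 := by exact_mod_cast e1
  rw [e2]
  linarith

/-- The words of length less than `m`. -/
def wordsBelow (n : ℕ) : ℕ → Finset (List (Fin n))
  | 0 => ∅
  | m + 1 => insert [] ((Finset.univ ×ˢ wordsBelow n m).image fun p => p.1 :: p.2)

theorem mem_wordsBelow (m : ℕ) (α : List (Fin n)) (h : α.length < m) : α ∈ wordsBelow n m := by
  induction m generalizing α with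
  | zero => omega
  | succ m ih =>
    cases α with
    | nil => simp [wordsBelow]
    | cons j β =>
      have := ih β (by simpa using h)
      simp [wordsBelow, this]

theorem adjoint_wordOp_cons (T : Fin n → H →L[ℂ] H) (i : Fin n) (β : List (Fin n)) (h : H) :
    (wordOp T (i :: β)).adjoint h = (wordOp T β).adjoint ((T i).adjoint h) := by
  have : wordOp T (i :: β) = T i ∘L wordOp T β := by
    simp [wordOp, ContinuousLinearMap.mul_def]
  rw [this, ContinuousLinearMap.adjoint_comp]
  rfl

theorem sum_wordsBelow_le {T : Fin n → H →L[ℂ] H} (hT : IsRowContraction T) (m : ℕ) (h : H) :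
    ∑ α ∈ wordsBelow n m, ‖defectVec T ((wordOp T α).adjoint h)‖ ^ 2 ≤ ‖h‖ ^ 2 := by
  induction m generalizing h with
  | zero => simp [wordsBelow]
  | succ m ih =>
    rw [wordsBelow, Finset.sum_insert (by simp), Finset.sum_image, Finset.sum_product]
    · have h0 : (wordOp T []).adjoint h = h := by
        have : wordOp T [] = ContinuousLinearMap.id ℂ H := rfl
        rw [this, ContinuousLinearMap.adjoint_id]
        rfl
      rw [h0, ← norm_sq_defect hT h]
      gcongr with i
      simp only [adjoint_wordOp_cons]
      exact ih _
    · rintro ⟨i, β⟩ - ⟨j, γ⟩ - hij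
      simpa using hij

theorem sum_defect_le {T : Fin n → H →L[ℂ] H} (hT : IsRowContraction T) (h : H)
    (s : Finset (List (Fin n))) :
    ∑ α ∈ s, ‖defectVec T ((wordOp T α).adjoint h)‖ ^ 2 ≤ ‖h‖ ^ 2 := by
  refine (Finset.sum_le_sum_of_subset_of_nonneg (fun α hα => ?_)
    (fun _ _ _ => sq_nonneg _)).trans (sum_wordsBelow_le hT (s.sup List.length + 1) h)
  exact mem_wordsBelow _ _ (Nat.lt_succ_of_le (Finset.le_sup (f := List.length) hα))

/-- The isometric embedding `d ↦ e_α ⊗ d`. -/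
def tmulBasis (D : Type*) [NormedAddCommGroup D] [InnerProductSpace ℂ D] (α : List (Fin n)) :
    D →ₗᵢ[ℂ] HilbertTensor (Fock n) D where
  toFun d := tmulH (fockBasis α) d
  map_add' d d' := by
    simp only [tmulH, TensorProduct.tmul_add, UniformSpace.Completion.coe_add]
  map_smul' c d := by
    simp only [tmulH, TensorProduct.tmul_smul, UniformSpace.Completion.coe_smul, RingHom.id_apply]
  norm_map' d := by
    simp [tmulH, fockBasis, lp.norm_single]

theorem tmulBasis_orthogonal (D : Type*) [NormedAddCommGroup D] [InnerProductSpace ℂ D] :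
    OrthogonalFamily ℂ (fun _ : List (Fin n) => D) (tmulBasis D) := by
  intro α β hαβ d d'
  change ⟪tmulH (fockBasis α) d, tmulH (fockBasis β) d'⟫_ℂ = 0
  rw [tmulH, tmulH, UniformSpace.Completion.inner_coe, TensorProduct.inner_tmul]
  have : ⟪(fockBasis α : Fock n), fockBasis β⟫_ℂ = 0 := by
    rw [fockBasis, lp.inner_single_left]
    simp [fockBasis, lp.single_apply, hαβ]
  rw [this, zero_mul]

/-- The term `e_α ⊗ Δ_T T_α* h` of the Poisson kernel. -/
def poissonTerm (T : Fin n → H →L[ℂ] H) (h : H) (α : List (Fin n)) :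
    HilbertTensor (Fock n) (defectSpace T) :=
  tmulH (fockBasis α) (defectVec T ((wordOp T α).adjoint h))

theorem poissonTerm_summable {T : Fin n → H →L[ℂ] H} (hT : IsRowContraction T) (h : H) :
    Summable (poissonTerm T h) :=
  ((tmulBasis_orthogonal (n := n) (defectSpace T)).summable_iff_norm_sq_summable
    fun α => defectVec T ((wordOp T α).adjoint h)).2
    (summable_of_sum_le (fun _ => sq_nonneg _) (sum_defect_le hT h))

theorem poissonTerm_norm_le {T : Fin n → H →L[ℂ] H} (hT : IsRowContraction T) (h : H) :
    ‖∑' α, poissonTerm T h α‖ ≤ ‖h‖ := by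
  refine le_of_tendsto (poissonTerm_summable hT h).hasSum.norm (Eventually.of_forall fun s => ?_)
  refine (sq_le_sq₀ (norm_nonneg _) (norm_nonneg _)).1 ?_
  have := (tmulBasis_orthogonal (n := n) (defectSpace T)).norm_sum
    (fun α => defectVec T ((wordOp T α).adjoint h)) s
  exact this.trans_le (sum_defect_le hT h s)

/-- The Poisson kernel `K_T h = ∑_α e_α ⊗ Δ_T T_α* h` of a row contraction. -/
def poissonKernel (T : Fin n → H →L[ℂ] H) (hT : IsRowContraction T) :
    H →L[ℂ] HilbertTensor (Fock n) (defectSpace T) :=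
  LinearMap.mkContinuous
    { toFun := fun h => ∑' α, poissonTerm T h α
      map_add' := by
        intro h h'
        rw [← (poissonTerm_summable hT h).tsum_add (poissonTerm_summable hT h')]
        refine tsum_congr fun α => ?_
        have : defectVec T ((wordOp T α).adjoint (h + h')) =
            defectVec T ((wordOp T α).adjoint h) + defectVec T ((wordOp T α).adjoint h') := by
          ext; simp [defectVec]
        simp only [poissonTerm, this]
        exact (tmulBasis _ α).map_add _ _
      map_smul' := by
        intro c h
        rw [RingHom.id_apply, ← (poissonTerm_summable hT h).tsum_const_smul c]
        refine tsum_congr fun α => ?_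
        have : defectVec T ((wordOp T α).adjoint (c • h)) =
            c • defectVec T ((wordOp T α).adjoint h) := by
          ext; simp [defectVec]
        simp only [poissonTerm, this]
        exact (tmulBasis _ α).map_smul _ _ }
    1 (by
      intro h
      rw [one_mul]
      exact poissonTerm_norm_le hT h)

end RowContraction

/-! ### The constrained objects attached to an ideal `J` of `Fₙ^∞` -/

section Constrained

variable {n : ℕ}

/-- The two-sided ideal `J` of `Fₙ^∞` is WOT-closed, as a set of operators on the Fock space. -/
def IsWOTClosedIdeal (J : TwoSidedIdeal (toeplitzAlgebra n)) : Prop :=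
  IsWOTClosed {φ : Fock n →L[ℂ] Fock n | ∃ f : toeplitzAlgebra n, f ∈ J ∧ f = φ}

/-- `M_J`, the closed linear span of `J F²(Hₙ)`. -/
def MJ (J : TwoSidedIdeal (toeplitzAlgebra n)) : Submodule ℂ (Fock n) :=
  (Submodule.span ℂ {ξ : Fock n | ∃ f : toeplitzAlgebra n, f ∈ J ∧
    ∃ η : Fock n, ξ = (f : Fock n →L[ℂ] Fock n) η}).topologicalClosure

/-- `N_J`, the orthogonal complement of `M_J` in the full Fock space. -/
abbrev NJ (J : TwoSidedIdeal (toeplitzAlgebra n)) : Submodule ℂ (Fock n) := (MJ J)ᗮ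

/-- The orthogonal projection `P_{N_J}`, as an operator onto `N_J`. -/
def projNJ (J : TwoSidedIdeal (toeplitzAlgebra n)) : Fock n →L[ℂ] NJ J :=
  (NJ J).orthogonalProjectionOnto

/-- The constrained left creation operators `Bᵢ = P_{N_J} Sᵢ |_{N_J}`. -/
def constrainedShift (J : TwoSidedIdeal (toeplitzAlgebra n)) (i : Fin n) : NJ J →L[ℂ] NJ J :=
  projNJ J ∘L leftCreation i ∘L (NJ J).subtypeL

/-- `W(B₁, …, Bₙ)`: the `w^*`-closed algebra generated by `B₁, …, Bₙ` and the identity. -/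
def constrainedAlgebra (J : TwoSidedIdeal (toeplitzAlgebra n)) :
    Subalgebra ℂ (NJ J →L[ℂ] NJ J) :=
  sInf {A | (∀ i, constrainedShift J i ∈ A) ∧ IsWeakStarClosed (A : Set (NJ J →L[ℂ] NJ J))}

/-- The constrained Poisson kernel `K_{J,T} = (P_{N_J} ⊗ I) K_T`. -/
def constrainedKernel {H : Type*} [NormedAddCommGroup H] [InnerProductSpace ℂ H] [CompleteSpace H]
    (J : TwoSidedIdeal (toeplitzAlgebra n)) (T : Fin n → H →L[ℂ] H) (hT : IsRowContraction T) :
    H →L[ℂ] HilbertTensor (NJ J) (defectSpace T) :=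
  tensorId (defectSpace T) (projNJ J) ∘L poissonKernel T hT

end Constrained

end NCVariety

end

open NCVariety

/-!
The Poisson kernel `K` of a row contraction `T` satisfies `K* (Sᵢ ⊗ I) = Tᵢ K*` and
`K* K = I - lim ∑_{|α| = k} T_α T_α*`. Applied to `rT`, where the limit is zero, it gives
`f(rT) = K* (f ⊗ I) K` for every `f` that commutes with the right creation operators
(`poissonKernel_smul_adjoint_comp_self`, `IsRowContraction.norm_tsum_radialTerm_le`), hence the
von Neumann inequality `‖f(rT)‖ ≤ ‖f‖`. For `T = S` the radial means are thus bounded and converge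
strongly to `f` (`hasFunctionalCalculus_leftCreation`), so that `Fₙ^∞` is the commutant of the
right creation operators (`toeplitzAlgebra_eq_rightCommutant`).

If `φ(T) = 0` for `φ ∈ J`, then `K*` vanishes on `M_J ⊗ D`, where `D` is the defect space. So
passing from `K` to `K_{J,T} = (P_{N_J} ⊗ I) K` loses nothing: `K_{J,T}* K_{J,T} = K* K`, and
`K_{J,T}*` intertwines `Bᵢ ⊗ I` and `Tᵢ`. Complete non-coisometry says exactly that `K`, hence
`K_{J,T}`, is injective.

For the last assertion, if `f(B) = X`, then `f(rT) K_{J,T}* = K_{J,T}* (f(rB) ⊗ I)` shows that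
`f(rT)` converges to `Ψ(X)` on a total subset of the range of `K_{J,T}*`; that range is dense, and
the von Neumann inequality extends the convergence to `H`
(`hasFunctionalCalculus_of_constrainedShift`).

That every `X ∈ W(B₁, …, Bₙ)` is some `f(B)` is a commutant lifting theorem (`exists_lift`). Such an
`X` commutes with the compressions of the right creation operators `Rᵢ`, and an operator on `N_J`
with this property is the compression of an operator commuting with the `Rᵢ`. The lifting is
constructed by a lurking isometry argument: with `Z = X*` a contraction and
`G = (I - Z* Z)^{1/2}`, the identity
`‖G h‖² + |(Z h)_∅|² = ∑ᵢ ‖G Rᵢ* h‖² + |h_∅|²` on `N_J` is realized by a contraction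
`N_Jⁿ ⊕ ℂ → N_J ⊕ ℂ`, and iterating the latter gives an extension of `Z` to the whole Fock space.
-/

namespace NCVariety

/-! ### Coordinates and creation operators on the full Fock space -/

section FockSpace

variable {n : ℕ}

theorem fockBasis_apply (α β : List (Fin n)) : fockBasis α β = if β = α then 1 else 0 := by
  classical
  rw [fockBasis, lp.single_apply, Pi.single_apply]

theorem inner_fockBasis (α : List (Fin n)) (h : Fock n) : ⟪fockBasis α, h⟫_ℂ = h α := by
  rw [fockBasis, lp.inner_single_left]
  simp

theorem hasSum_fockBasis (h : Fock n) : HasSum (fun α => h α • fockBasis α) h := by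
  have := lp.hasSum_single (p := 2) (by norm_num) h
  convert this using 2 with α
  rw [fockBasis, ← lp.single_smul, smul_eq_mul, mul_one]

theorem orthonormal_fockBasis : Orthonormal ℂ (fockBasis : List (Fin n) → Fock n) := by
  rw [orthonormal_iff_ite]
  intro α β
  rw [inner_fockBasis, fockBasis_apply]

/-- Operators on the Fock space that agree on the basis vectors are equal. -/
theorem ext_fockBasis {E : Type*} [NormedAddCommGroup E] [NormedSpace ℂ E]
    {A B : Fock n →L[ℂ] E} (h : ∀ α, A (fockBasis α) = B (fockBasis α)) : A = B := by
  ext φ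
  have hA := (hasSum_fockBasis φ).mapL A
  have hB := (hasSum_fockBasis φ).mapL B
  simp only [map_smul, h] at hA hB
  exact hA.unique hB

theorem leftCreation_fockBasis (i : Fin n) (α : List (Fin n)) :
    leftCreation i (fockBasis α) = fockBasis (i :: α) := by
  ext β
  rw [fockBasis_apply]
  change prependCoord i (fockBasis α) β = _
  cases β with
  | nil => simp [prependCoord]
  | cons j β =>
    simp only [prependCoord, fockBasis_apply, List.cons.injEq]
    split_ifs <;> simp_all

theorem leftCreation_adjoint_apply (i : Fin n) (h : Fock n) (α : List (Fin n)) :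
    (leftCreation i).adjoint h α = h (i :: α) := by
  rw [← inner_fockBasis, ContinuousLinearMap.adjoint_inner_right, leftCreation_fockBasis,
    inner_fockBasis]

/-- The right creation operator `φ ↦ φ ⊗ eᵢ` on the full Fock space, encoded as the isometry that
carries the basis vector `e_α` to `e_{α ++ [i]}`. -/
noncomputable def rightCreation (i : Fin n) : Fock n →L[ℂ] Fock n :=
  ((orthonormal_fockBasis.comp (fun α : List (Fin n) => α ++ [i])
    (List.append_left_injective [i])).orthogonalFamily.linearIsometry).toContinuousLinearMap

theorem rightCreation_fockBasis (i : Fin n) (α : List (Fin n)) :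
    rightCreation i (fockBasis α) = fockBasis (α ++ [i]) := by
  have := (orthonormal_fockBasis.comp (fun α : List (Fin n) => α ++ [i])
    (List.append_left_injective [i])).orthogonalFamily.linearIsometry_apply_single (i := α) 1
  refine this.trans ?_
  simp

theorem rightCreation_adjoint_apply (i : Fin n) (h : Fock n) (α : List (Fin n)) :
    (rightCreation i).adjoint h α = h (α ++ [i]) := by
  rw [← inner_fockBasis, ContinuousLinearMap.adjoint_inner_right, rightCreation_fockBasis,
    inner_fockBasis]

theorem rightCreation_comp_leftCreation (i j : Fin n) :
    rightCreation i ∘L leftCreation j = leftCreation j ∘L rightCreation i := by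
  refine ext_fockBasis fun α => ?_
  simp [rightCreation_fockBasis, leftCreation_fockBasis]

theorem hasSum_norm_sq_coord (h : Fock n) : HasSum (fun α => ‖h α‖ ^ 2) (‖h‖ ^ 2) := by
  simpa using lp.hasSum_norm (p := 2) (by norm_num) h

/-- Pythagoras for a decomposition of `h` into its vacuum component and components `Vᵢ Vᵢ* h`. -/
theorem norm_sq_eq_vacuum_add {V : Fin n → Fock n →L[ℂ] Fock n} (h : Fock n)
    (hV : h = h [] • fockBasis [] + ∑ i, V i ((V i).adjoint h)) :
    ‖h‖ ^ 2 = ‖h []‖ ^ 2 + ∑ i, ‖(V i).adjoint h‖ ^ 2 := by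
  have key : ((‖h‖ : ℂ)) ^ 2 = (‖h []‖ : ℂ) ^ 2 + ∑ i, (‖(V i).adjoint h‖ : ℂ) ^ 2 := by
    calc (‖h‖ : ℂ) ^ 2 = ⟪h, h⟫_ℂ := (inner_self_eq_norm_sq_to_K h).symm
      _ = ⟪h [] • fockBasis [] + ∑ i, V i ((V i).adjoint h), h⟫_ℂ := by rw [← hV]
      _ = _ := by
        rw [inner_add_left, inner_smul_left, inner_fockBasis, sum_inner]
        congr 1
        · rw [Complex.conj_mul']
        · refine Finset.sum_congr rfl fun i _ => ?_
          rw [← ContinuousLinearMap.adjoint_inner_right]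
          exact inner_self_eq_norm_sq_to_K _
  exact_mod_cast key

theorem eq_vacuum_add_leftCreation (h : Fock n) :
    h = h [] • fockBasis [] + ∑ i, leftCreation i ((leftCreation i).adjoint h) := by
  suffices hid : ContinuousLinearMap.id ℂ (Fock n) =
      (innerSL ℂ (fockBasis [])).smulRight (fockBasis []) +
        ∑ i, leftCreation i ∘L (leftCreation i).adjoint by
    simpa [inner_fockBasis, sum_apply] using congrArg (fun A : Fock n →L[ℂ] Fock n => A h) hid
  · refine ext_fockBasis fun α => ?_
    cases α with
    | nil =>
      have : ∀ i : Fin n, (leftCreation i).adjoint (fockBasis []) = 0 := fun i => by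
        ext β
        rw [leftCreation_adjoint_apply, fockBasis_apply]
        simp
      simp [this, sum_apply, orthonormal_fockBasis.1 []]
    | cons j α =>
      have : ∀ i : Fin n, (leftCreation i).adjoint (fockBasis (j :: α)) =
          if i = j then fockBasis α else 0 := fun i => by
        ext β
        rw [leftCreation_adjoint_apply, fockBasis_apply]
        split_ifs <;> simp_all [fockBasis_apply]
      simp [inner_fockBasis, fockBasis_apply, this, sum_apply, apply_ite,
        leftCreation_fockBasis]

theorem norm_sq_eq_vacuum_add_leftCreation (h : Fock n) :
    ‖h‖ ^ 2 = ‖h []‖ ^ 2 + ∑ i, ‖(leftCreation i).adjoint h‖ ^ 2 :=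
  norm_sq_eq_vacuum_add h (eq_vacuum_add_leftCreation h)

theorem eq_vacuum_add_rightCreation (h : Fock n) :
    h = h [] • fockBasis [] + ∑ i, rightCreation i ((rightCreation i).adjoint h) := by
  suffices hid : ContinuousLinearMap.id ℂ (Fock n) =
      (innerSL ℂ (fockBasis [])).smulRight (fockBasis []) +
        ∑ i, rightCreation i ∘L (rightCreation i).adjoint by
    simpa [inner_fockBasis, sum_apply] using congrArg (fun A : Fock n →L[ℂ] Fock n => A h) hid
  · refine ext_fockBasis fun α => ?_
    rcases α.eq_nil_or_concat with rfl | ⟨α, j, rfl⟩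
    · have : ∀ i : Fin n, (rightCreation i).adjoint (fockBasis []) = 0 := fun i => by
        ext β
        rw [rightCreation_adjoint_apply, fockBasis_apply]
        simp
      simp [this, sum_apply, orthonormal_fockBasis.1 []]
    · have : ∀ i : Fin n, (rightCreation i).adjoint (fockBasis (α ++ [j])) =
          if i = j then fockBasis α else 0 := fun i => by
        ext β
        rw [rightCreation_adjoint_apply, fockBasis_apply]
        split_ifs <;> simp_all [fockBasis_apply]
      simp [inner_fockBasis, fockBasis_apply, this, sum_apply, apply_ite,
        rightCreation_fockBasis]

theorem norm_sq_eq_vacuum_add_rightCreation (h : Fock n) :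
    ‖h‖ ^ 2 = ‖h []‖ ^ 2 + ∑ i, ‖(rightCreation i).adjoint h‖ ^ 2 :=
  norm_sq_eq_vacuum_add h (eq_vacuum_add_rightCreation h)

/-! ### Operators commuting with the right creation operators -/

/-- The commutant of the right creation operators; it turns out to be `Fₙ^∞`. -/
noncomputable def rightCommutant (n : ℕ) : Subalgebra ℂ (Fock n →L[ℂ] Fock n) :=
  Subalgebra.centralizer ℂ (Set.range rightCreation)

theorem mem_rightCommutant {f : Fock n →L[ℂ] Fock n} :
    f ∈ rightCommutant n ↔ ∀ i h, f (rightCreation i h) = rightCreation i (f h) := by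
  simp only [rightCommutant, Subalgebra.mem_centralizer_iff, Set.forall_mem_range,
    ContinuousLinearMap.ext_iff]
  exact forall₂_congr fun i h => eq_comm

theorem leftCreation_mem_rightCommutant (i : Fin n) : leftCreation i ∈ rightCommutant n := by
  rw [mem_rightCommutant]
  exact fun j h => (ContinuousLinearMap.ext_iff.1 (rightCreation_comp_leftCreation j i) h).symm

theorem wordOp_nil {H : Type*} [NormedAddCommGroup H] [InnerProductSpace ℂ H]
    (T : Fin n → H →L[ℂ] H) : wordOp T [] = 1 := rfl

theorem wordOp_cons {H : Type*} [NormedAddCommGroup H] [InnerProductSpace ℂ H]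
    (T : Fin n → H →L[ℂ] H) (i : Fin n) (α : List (Fin n)) :
    wordOp T (i :: α) = T i ∘L wordOp T α := by
  simp [wordOp, ContinuousLinearMap.mul_def]

theorem wordOp_leftCreation_fockBasis (α β : List (Fin n)) :
    wordOp leftCreation α (fockBasis β) = fockBasis (α ++ β) := by
  induction α with
  | nil => rfl
  | cons i α ih => simp [wordOp_cons, ih, leftCreation_fockBasis]

/-- A family indexed by the words can be summed by word length. -/
theorem hasSum_by_length {E : Type*} [NormedAddCommGroup E] {F : List (Fin n) → E} {x : E}
    (hF : HasSum F x) : HasSum (fun k => ∑ α : Fin k → Fin n, F (List.ofFn α)) x := by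
  have h1 : HasSum (fun p : Σ k, (Fin k → Fin n) => F (List.ofFn p.2)) x :=
    (List.equivSigmaTuple (α := Fin n)).symm.hasSum_iff.2 hF
  exact h1.sigma fun k => hasSum_fintype _

/-- An operator `f` in the commutant of the right creation operators is determined by `f 1`:
`f e_β = (f 1) ⊗ e_β`. -/
theorem hasSum_rightCommutant_fockBasis {f : Fock n →L[ℂ] Fock n} (hf : f ∈ rightCommutant n)
    (β : List (Fin n)) :
    HasSum (fun α => fourierCoeff f α • wordOp leftCreation α (fockBasis β))
      (f (fockBasis β)) := by
  induction β using List.reverseRecOn with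
  | nil =>
    simpa [wordOp_leftCreation_fockBasis, fourierCoeff] using hasSum_fockBasis (f (fockBasis []))
  | append_singleton β i ih =>
    have := ih.mapL (rightCreation i)
    rw [← mem_rightCommutant.1 hf] at this
    simpa [wordOp_leftCreation_fockBasis, rightCreation_fockBasis] using this

end FockSpace

/-! ### Strong convergence of bounded families of operators -/

section StrongConvergence

variable {E F ι : Type*} [NormedAddCommGroup E] [InnerProductSpace ℂ E]
  [NormedAddCommGroup F] [InnerProductSpace ℂ F]

theorem isClosed_setOf_tendsto_apply {A : ι → E →L[ℂ] F} {l : Filter ι} {C : ℝ}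
    (hC : ∀ᶠ i in l, ‖A i‖ ≤ C) (B : E →L[ℂ] F) :
    IsClosed {h | Tendsto (fun i => A i h) l (𝓝 (B h))} := by
  refine isClosed_of_closure_subset fun h hh => ?_
  rw [Set.mem_ofPred_eq, Metric.tendsto_nhds]
  intro ε hε
  have hM : 0 < |C| + ‖B‖ + 1 := by positivity
  obtain ⟨h', hh', hd⟩ := Metric.mem_closure_iff.1 hh (ε / (2 * (|C| + ‖B‖ + 1))) (by positivity)
  filter_upwards [hC, Metric.tendsto_nhds.1 hh' (ε / 2) (by positivity)] with i hi hi'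
  rw [dist_eq_norm] at hi' hd ⊢
  have e : A i h - B h = (A i (h - h') - B (h - h')) + (A i h' - B h') := by
    simp only [map_sub]; abel
  have h1 : ‖A i (h - h')‖ ≤ |C| * ‖h - h'‖ :=
    ((A i).le_opNorm _).trans (by gcongr; exact hi.trans (le_abs_self C))
  have h2 : ‖B (h - h')‖ ≤ ‖B‖ * ‖h - h'‖ := B.le_opNorm _
  have h3 : (|C| + ‖B‖ + 1) * ‖h - h'‖ < ε / 2 := by
    rw [lt_div_iff₀ (by positivity)] at hd
    linarith
  rw [e]
  have h4 := norm_add_le (A i (h - h') - B (h - h')) (A i h' - B h')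
  have h5 := norm_sub_le (A i (h - h')) (B (h - h'))
  nlinarith [norm_nonneg (h - h')]

/-- A bounded family of operators that converges on a total set converges strongly. -/
theorem tendsto_apply_of_total [CompleteSpace E] {A : ι → E →L[ℂ] F} {l : Filter ι} {C : ℝ}
    (hC : ∀ᶠ i in l, ‖A i‖ ≤ C) (B : E →L[ℂ] F) {s : Set E}
    (hs : ∀ h : E, (∀ x ∈ s, ⟪x, h⟫_ℂ = 0) → h = 0)
    (hA : ∀ x ∈ s, Tendsto (fun i => A i x) l (𝓝 (B x))) (h : E) :
    Tendsto (fun i => A i h) l (𝓝 (B h)) := by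
  let V : Submodule ℂ E :=
    { carrier := {h | Tendsto (fun i => A i h) l (𝓝 (B h))}
      add_mem' := fun {x y} hx hy => by
        simpa only [Set.mem_ofPred_eq, map_add] using Tendsto.add hx hy
      zero_mem' := by simpa only [Set.mem_ofPred_eq, map_zero] using tendsto_const_nhds
      smul_mem' := fun c x hx => by
        simpa only [Set.mem_ofPred_eq, map_smul] using Tendsto.const_smul hx c }
  have hV : V.topologicalClosure = ⊤ := by
    rw [Submodule.topologicalClosure_eq_top_iff, Submodule.eq_bot_iff]
    exact fun x hx => hs x fun y hy => (Submodule.mem_orthogonal _ _).1 hx y (hA y hy)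
  have hcl : V.topologicalClosure ≤ V :=
    (V.topologicalClosure_minimal le_rfl (isClosed_setOf_tendsto_apply hC B))
  exact hcl (hV ▸ Submodule.mem_top : h ∈ V.topologicalClosure)

end StrongConvergence

/-! ### Radial dilations of the full Fock space -/

section Dilation

variable {n : ℕ}

theorem eq_zero_of_forall_inner_fockBasis (h : Fock n)
    (hh : ∀ x ∈ Set.range (fockBasis : List (Fin n) → Fock n), ⟪x, h⟫_ℂ = 0) : h = 0 := by
  ext α
  rw [← inner_fockBasis, hh _ ⟨α, rfl⟩]
  rfl

/-- The contraction `e_α ↦ c^{|α|} e_α` of the full Fock space. The parameter `c` is taken from the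
unit interval, since the operator is unbounded for larger `c`. -/
noncomputable def dilation (n : ℕ) (c : Set.Icc (0 : ℝ) 1) : Fock n →L[ℂ] Fock n :=
  have hle (φ : Fock n) (α : List (Fin n)) : ‖((c : ℝ) : ℂ) ^ α.length * φ α‖ ≤ ‖φ α‖ := by
    rw [norm_mul, norm_pow, Complex.norm_real, Real.norm_of_nonneg c.2.1]
    exact mul_le_of_le_one_left (norm_nonneg _) (pow_le_one₀ c.2.1 c.2.2)
  have hsum (φ : Fock n) : Summable fun α => ‖((c : ℝ) : ℂ) ^ α.length * φ α‖ ^ 2 :=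
    (hasSum_norm_sq_coord φ).summable.of_nonneg_of_le (fun _ => by positivity)
      fun α => by gcongr; exact hle φ α
  have hmem (φ : Fock n) : Memℓp (E := fun _ : List (Fin n) => ℂ)
      (fun α => ((c : ℝ) : ℂ) ^ α.length * φ α) 2 :=
    memℓp_gen (by simpa using hsum φ)
  LinearMap.mkContinuous
    { toFun := fun φ => (⟨fun α => ((c : ℝ) : ℂ) ^ α.length * φ α, hmem φ⟩ : Fock n)
      map_add' := fun φ ψ => by ext α; exact mul_add _ _ _
      map_smul' := fun a φ => by ext α; exact mul_left_comm _ _ _ }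
    1 fun φ => by
      rw [one_mul]
      refine (sq_le_sq₀ (norm_nonneg _) (norm_nonneg _)).1 ?_
      exact hasSum_le (fun α => by gcongr; exact hle φ α)
        (hasSum_norm_sq_coord (⟨_, hmem φ⟩ : Fock n)) (hasSum_norm_sq_coord φ)

theorem dilation_apply (c : Set.Icc (0 : ℝ) 1) (φ : Fock n) (α : List (Fin n)) :
    dilation n c φ α = ((c : ℝ) : ℂ) ^ α.length * φ α := rfl

theorem norm_dilation_le (c : Set.Icc (0 : ℝ) 1) : ‖dilation n c‖ ≤ 1 := by
  unfold dilation
  exact LinearMap.mkContinuous_norm_le _ zero_le_one _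

theorem dilation_fockBasis (c : Set.Icc (0 : ℝ) 1) (α : List (Fin n)) :
    dilation n c (fockBasis α) = ((c : ℝ) : ℂ) ^ α.length • fockBasis α := by
  ext β
  rw [dilation_apply, lp.coeFn_smul, Pi.smul_apply, smul_eq_mul, fockBasis_apply]
  split_ifs with h
  · rw [h]
  · simp

end Dilation

/-! ### Words in a row contraction -/

section Words

variable {n : ℕ}

theorem sum_words_succ {M : Type*} [AddCommMonoid M] (F : List (Fin n) → M) (k : ℕ) :
    ∑ α : Fin (k + 1) → Fin n, F (List.ofFn α) =
      ∑ i, ∑ α : Fin k → Fin n, F (i :: List.ofFn α) := by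
  rw [← (Fin.consEquiv fun _ : Fin (k + 1) => Fin n).sum_comp, Fintype.sum_prod_type]
  simp [Fin.consEquiv, List.ofFn_succ]

theorem sum_wordsBelow_succ {M : Type*} [AddCommMonoid M] (F : List (Fin n) → M) (m : ℕ) :
    ∑ α ∈ wordsBelow n (m + 1), F α = F [] + ∑ i, ∑ α ∈ wordsBelow n m, F (i :: α) := by
  rw [wordsBelow, Finset.sum_insert (by simp), Finset.sum_image, Finset.sum_product]
  rintro ⟨i, β⟩ - ⟨j, γ⟩ - hij
  simpa using hij

theorem length_lt_of_mem_wordsBelow {m : ℕ} {α : List (Fin n)} (h : α ∈ wordsBelow n m) :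
    α.length < m := by
  induction m generalizing α with
  | zero => simp [wordsBelow] at h
  | succ m ih =>
    rw [wordsBelow, Finset.mem_insert, Finset.mem_image] at h
    rcases h with rfl | ⟨⟨i, β⟩, hp, rfl⟩
    · simp
    · have := ih (Finset.mem_product.1 hp).2
      simpa using this

theorem tendsto_wordsBelow : Tendsto (wordsBelow n) atTop atTop :=
  tendsto_atTop_finset_of_monotone
    (fun _ _ hab _ hα => mem_wordsBelow _ _ ((length_lt_of_mem_wordsBelow hα).trans_le hab))
    fun α => ⟨α.length + 1, mem_wordsBelow _ _ (Nat.lt_succ_self _)⟩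

variable {H : Type*} [NormedAddCommGroup H] [InnerProductSpace ℂ H]

theorem wordOp_smul (T : Fin n → H →L[ℂ] H) (c : ℂ) (α : List (Fin n)) :
    wordOp (fun i => c • T i) α = c ^ α.length • wordOp T α := by
  induction α with
  | nil => simp [wordOp_nil]
  | cons i α ih =>
    ext h
    simp [wordOp_cons, ih, pow_succ', mul_smul, smul_comm c]

/-- The terms of the series for `f(rT)` are those of the series for `f` at the row `rT`. -/
theorem radialTerm_eq (T : Fin n → H →L[ℂ] H) (f : Fock n →L[ℂ] Fock n) (r : ℝ) (k : ℕ) :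
    radialTerm T f r k = ∑ α : Fin k → Fin n,
      fourierCoeff f (List.ofFn α) • wordOp (fun i => (r : ℂ) • T i) (List.ofFn α) := by
  refine Finset.sum_congr rfl fun α _ => ?_
  rw [wordOp_smul, smul_smul, List.length_ofFn, mul_comm]

theorem wordOp_mem {A : Subalgebra ℂ (H →L[ℂ] H)} {T : Fin n → H →L[ℂ] H}
    (hT : ∀ i, T i ∈ A) (α : List (Fin n)) : wordOp T α ∈ A :=
  A.list_prod_mem fun _ hx => by
    obtain ⟨i, -, rfl⟩ := List.mem_map.1 hx
    exact hT i

/-- Intertwining relations pass to words. -/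
theorem map_wordOp {H' : Type*} [NormedAddCommGroup H'] [InnerProductSpace ℂ H']
    {X : Fin n → H' →L[ℂ] H'} {T : Fin n → H →L[ℂ] H} {L : H' →L[ℂ] H}
    (hL : ∀ i x, L (X i x) = T i (L x)) (α : List (Fin n)) (x : H') :
    L (wordOp X α x) = wordOp T α (L x) := by
  induction α with
  | nil => rfl
  | cons i α ih => simp [wordOp_cons, hL, ih]

/-- Intertwining relations pass to the homogeneous terms of the series for `f(rT)`. -/
theorem map_radialTerm {H' : Type*} [NormedAddCommGroup H'] [InnerProductSpace ℂ H']
    {X : Fin n → H' →L[ℂ] H'} {T : Fin n → H →L[ℂ] H} {L : H' →L[ℂ] H}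
    (hL : ∀ i x, L (X i x) = T i (L x)) (f : Fock n →L[ℂ] Fock n) (r : ℝ) (k : ℕ) (x : H') :
    L (radialTerm X f r k x) = radialTerm T f r k (L x) := by
  simp [radialTerm, sum_apply, map_wordOp hL]

/-- Intertwining relations pass to the sums `f(rX)` and `f(rT)`. -/
theorem map_tsum_radialTerm {H' : Type*} [NormedAddCommGroup H'] [InnerProductSpace ℂ H']
    {X : Fin n → H' →L[ℂ] H'} {T : Fin n → H →L[ℂ] H} {L : H' →L[ℂ] H}
    (hL : ∀ i x, L (X i x) = T i (L x)) {f : Fock n →L[ℂ] Fock n} {r : ℝ}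
    (hX : Summable (radialTerm X f r)) (hT : Summable (radialTerm T f r)) (x : H') :
    L ((∑' k, radialTerm X f r k) x) = (∑' k, radialTerm T f r k) (L x) := by
  have h1 := (hX.hasSum.mapL (ContinuousLinearMap.apply ℂ H' x)).mapL L
  have h2 := hT.hasSum.mapL (ContinuousLinearMap.apply ℂ H (L x))
  simp only [ContinuousLinearMap.apply_apply, map_radialTerm hL] at h1 h2
  exact h1.unique h2

variable [CompleteSpace H]

theorem isRowContraction_of_sum_norm_sq_le {T : Fin n → H →L[ℂ] H}
    (h : ∀ x, ∑ i, ‖(T i).adjoint x‖ ^ 2 ≤ ‖x‖ ^ 2) : IsRowContraction T := by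
  rw [IsRowContraction, ContinuousLinearMap.le_def, ContinuousLinearMap.isPositive_iff_complex]
  intro x
  have key : ⟪(1 - ∑ i, T i ∘L (T i).adjoint) x, x⟫_ℂ =
      ((‖x‖ ^ 2 - ∑ i, ‖(T i).adjoint x‖ ^ 2 : ℝ) : ℂ) := by
    have e : ∀ i, ⟪T i ((T i).adjoint x), x⟫_ℂ = (‖(T i).adjoint x‖ : ℂ) ^ 2 := fun i => by
      rw [← ContinuousLinearMap.adjoint_inner_right]
      exact inner_self_eq_norm_sq_to_K _
    have e' : ⟪x, x⟫_ℂ = (‖x‖ : ℂ) ^ 2 := inner_self_eq_norm_sq_to_K x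
    simp [sum_apply, e, e', -inner_self_eq_norm_sq_to_K]
  rw [key]
  exact ⟨by simp only [RCLike.re_to_complex, Complex.ofReal_re],
    by simpa only [RCLike.re_to_complex, Complex.ofReal_re, sub_nonneg] using h x⟩

theorem IsRowContraction.sum_norm_sq_le {T : Fin n → H →L[ℂ] H} (hT : IsRowContraction T)
    (x : H) : ∑ i, ‖(T i).adjoint x‖ ^ 2 ≤ ‖x‖ ^ 2 := by
  linarith [norm_sq_defect hT x, sq_nonneg ‖defectVec T x‖]

theorem IsRowContraction.smul {T : Fin n → H →L[ℂ] H} (hT : IsRowContraction T) {r : ℝ}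
    (hr : r ∈ Set.Ioo (0 : ℝ) 1) : IsRowContraction fun i => (r : ℂ) • T i := by
  refine isRowContraction_of_sum_norm_sq_le fun x => (le_trans ?_ (hT.sum_norm_sq_le x))
  refine Finset.sum_le_sum fun i _ => ?_
  gcongr
  rw [map_smulₛₗ, smul_apply, norm_smul]
  refine mul_le_of_le_one_left (norm_nonneg _) ?_
  simpa [abs_of_pos hr.1] using hr.2.le

theorem isRowContraction_leftCreation : IsRowContraction (leftCreation (n := n)) :=
  isRowContraction_of_sum_norm_sq_le fun x => by
    linarith [norm_sq_eq_vacuum_add_leftCreation x, sq_nonneg ‖x []‖]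

theorem wordOp_nil_adjoint (T : Fin n → H →L[ℂ] H) (h : H) : (wordOp T []).adjoint h = h := by
  have : wordOp T [] = ContinuousLinearMap.id ℂ H := rfl
  rw [this, ContinuousLinearMap.adjoint_id]
  rfl

theorem IsRowContraction.sum_norm_sq_words_le {T : Fin n → H →L[ℂ] H} (hT : IsRowContraction T)
    (k : ℕ) (h : H) :
    ∑ α : Fin k → Fin n, ‖(wordOp T (List.ofFn α)).adjoint h‖ ^ 2 ≤ ‖h‖ ^ 2 := by
  induction k generalizing h with
  | zero => simp [wordOp_nil_adjoint]
  | succ k ih =>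
    rw [sum_words_succ (fun α => ‖(wordOp T α).adjoint h‖ ^ 2)]
    simp only [adjoint_wordOp_cons]
    exact (Finset.sum_le_sum fun i _ => ih _).trans (hT.sum_norm_sq_le h)

/-- Homogeneous polynomials in a row contraction are bounded by the `ℓ²`-norm of their
coefficients. This makes the series for `f(rT)` converge geometrically. -/
theorem IsRowContraction.norm_homogeneous_le {T : Fin n → H →L[ℂ] H} (hT : IsRowContraction T)
    (k : ℕ) (c : List (Fin n) → ℂ) {C : ℝ} (hC : 0 ≤ C)
    (hc : ∑ α : Fin k → Fin n, ‖c (List.ofFn α)‖ ^ 2 ≤ C ^ 2) :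
    ‖∑ α : Fin k → Fin n, c (List.ofFn α) • wordOp T (List.ofFn α)‖ ≤ C := by
  refine ContinuousLinearMap.opNorm_le_of_re_inner_le hC fun x y hx hy => ?_
  have h1 := hT.sum_norm_sq_words_le k y
  rw [hy, one_pow] at h1
  calc RCLike.re ⟪(∑ α : Fin k → Fin n, c (List.ofFn α) • wordOp T (List.ofFn α)) x, y⟫_ℂ
      ≤ ‖⟪(∑ α : Fin k → Fin n, c (List.ofFn α) • wordOp T (List.ofFn α)) x, y⟫_ℂ‖ :=
        RCLike.re_le_norm _
    _ ≤ ∑ α : Fin k → Fin n, ‖c (List.ofFn α)‖ * ‖(wordOp T (List.ofFn α)).adjoint y‖ := by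
        rw [sum_apply, sum_inner]
        refine (norm_sum_le _ _).trans (Finset.sum_le_sum fun α _ => ?_)
        rw [smul_apply, inner_smul_left, norm_mul, RCLike.norm_conj,
          ← ContinuousLinearMap.adjoint_inner_right]
        gcongr
        exact (norm_inner_le_norm _ _).trans (by rw [hx, one_mul])
    _ ≤ √(∑ α : Fin k → Fin n, ‖c (List.ofFn α)‖ ^ 2) *
          √(∑ α : Fin k → Fin n, ‖(wordOp T (List.ofFn α)).adjoint y‖ ^ 2) :=
        Real.sum_mul_le_sqrt_mul_sqrt _ _ _
    _ ≤ C * 1 := by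
        gcongr
        · exact Real.sqrt_le_iff.2 ⟨hC, hc⟩
        · exact Real.sqrt_le_one.2 h1
    _ = C := mul_one C

theorem sum_norm_sq_words_coord_le (h : Fock n) (k : ℕ) :
    ∑ α : Fin k → Fin n, ‖h (List.ofFn α)‖ ^ 2 ≤ ‖h‖ ^ 2 := by
  rw [← Finset.sum_image (f := fun α => ‖h α‖ ^ 2) (g := List.ofFn)
    (fun _ _ _ _ hab => List.ofFn_injective hab)]
  exact sum_le_hasSum _ (fun _ _ => sq_nonneg _) (hasSum_norm_sq_coord h)

theorem IsRowContraction.summable_radialTerm {T : Fin n → H →L[ℂ] H} (hT : IsRowContraction T)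
    (f : Fock n →L[ℂ] Fock n) {r : ℝ} (hr : r ∈ Set.Ioo (0 : ℝ) 1) :
    Summable (radialTerm T f r) := by
  refine Summable.of_norm_bounded
    ((summable_geometric_of_lt_one hr.1.le hr.2).mul_right ‖f (fockBasis [])‖) fun k => ?_
  have h1 : radialTerm T f r k = (r : ℂ) ^ k •
      ∑ α : Fin k → Fin n, fourierCoeff f (List.ofFn α) • wordOp T (List.ofFn α) := by
    simp only [radialTerm, Finset.smul_sum, smul_smul]
  rw [h1, norm_smul, norm_pow, Complex.norm_real, Real.norm_of_nonneg hr.1.le]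
  gcongr
  · exact pow_nonneg hr.1.le k
  · exact hT.norm_homogeneous_le k (fourierCoeff f) (norm_nonneg _)
      (sum_norm_sq_words_coord_le (f (fockBasis [])) k)

end Words

/-! ### Hilbert space tensor products -/

section TensorLemmas

variable {E E' D : Type*} [NormedAddCommGroup E] [InnerProductSpace ℂ E]
  [NormedAddCommGroup E'] [InnerProductSpace ℂ E'] [NormedAddCommGroup D] [InnerProductSpace ℂ D]

theorem inner_tmulH (x x' : E) (y y' : D) :
    ⟪tmulH x y, tmulH x' y'⟫_ℂ = ⟪x, x'⟫_ℂ * ⟪y, y'⟫_ℂ := by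
  rw [tmulH, tmulH, UniformSpace.Completion.inner_coe, TensorProduct.inner_tmul]

/-- Bounded operators that agree on elementary tensors are equal. -/
theorem ext_tmulH {F : Type*} [NormedAddCommGroup F] [NormedSpace ℂ F]
    {A B : HilbertTensor E D →L[ℂ] F} (h : ∀ x y, A (tmulH x y) = B (tmulH x y)) : A = B := by
  ext z
  refine congrFun (UniformSpace.Completion.ext A.continuous B.continuous fun t => ?_) z
  induction t using TensorProduct.induction_on with
  | zero => rw [UniformSpace.Completion.coe_zero, map_zero, map_zero]
  | tmul x y => exact h x y
  | add s t hs ht => rw [UniformSpace.Completion.coe_add, map_add, map_add, hs, ht]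

theorem eq_zero_of_forall_inner_tmulH {z : HilbertTensor E D}
    (h : ∀ x y, ⟪(tmulH x y : HilbertTensor E D), z⟫_ℂ = 0) : z = 0 := by
  have : innerSL ℂ z = 0 := ext_tmulH fun x y => by
    rw [innerSL_apply_apply, ← inner_conj_symm, h, map_zero, zero_apply]
  rw [← inner_self_eq_zero (𝕜 := ℂ), ← innerSL_apply_apply ℂ, this, zero_apply]

theorem norm_tensorId_le (A : E →L[ℂ] E') : ‖tensorId D A‖ ≤ ‖A‖ := by
  refine ContinuousLinearMap.opNorm_le_bound _ (norm_nonneg _) fun z => ?_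
  induction z using UniformSpace.Completion.induction_on with
  | hp => exact isClosed_le (by fun_prop) (by fun_prop)
  | ih t =>
    rw [tensorId, ContinuousLinearMap.completion_apply_coe, UniformSpace.Completion.norm_coe,
      UniformSpace.Completion.norm_coe]
    exact ((A.rTensor D).le_opNorm t).trans
      (by gcongr; exact ContinuousLinearMap.norm_rTensor_le D A)

theorem tensorId_adjoint [CompleteSpace E] [CompleteSpace E'] (A : E →L[ℂ] E') :
    (tensorId D A).adjoint = tensorId D A.adjoint := by
  refine ext_tmulH fun x y => sub_eq_zero.1 (eq_zero_of_forall_inner_tmulH fun x' y' => ?_)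
  rw [inner_sub_right, ContinuousLinearMap.adjoint_inner_right, tensorId_tmulH, tensorId_tmulH,
    inner_tmulH, inner_tmulH, ContinuousLinearMap.adjoint_inner_right, sub_self]

/-- The operator `x ↦ x ⊗ d`. -/
noncomputable def tmulRight (E : Type*) [NormedAddCommGroup E] [InnerProductSpace ℂ E] (d : D) :
    E →L[ℂ] HilbertTensor E D :=
  LinearMap.mkContinuous
    { toFun := fun x => tmulH x d
      map_add' := fun x x' => by
        simp only [tmulH, TensorProduct.add_tmul, UniformSpace.Completion.coe_add]
      map_smul' := fun c x => by
        simp only [tmulH, ← TensorProduct.smul_tmul', UniformSpace.Completion.coe_smul,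
          RingHom.id_apply] }
    ‖d‖ fun x => by simp [tmulH, mul_comm]

theorem tmulRight_apply (x : E) (d : D) : tmulRight E d x = tmulH x d := rfl

end TensorLemmas

/-! ### The Poisson kernel -/

section Poisson

variable {n : ℕ} {H : Type*} [NormedAddCommGroup H] [InnerProductSpace ℂ H] [CompleteSpace H]
  {T : Fin n → H →L[ℂ] H}

theorem IsRowContraction.defect_mul_self (hT : IsRowContraction T) :
    defect T * defect T = 1 - ∑ i, T i ∘L (T i).adjoint :=
  CFC.sqrt_mul_sqrt_self _ (sub_nonneg.2 hT)

theorem defect_adjoint (T : Fin n → H →L[ℂ] H) : (defect T).adjoint = defect T :=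
  IsSelfAdjoint.of_nonneg (CFC.sqrt_nonneg _)

theorem hasSum_poissonKernel (hT : IsRowContraction T) (h : H) :
    HasSum (poissonTerm T h) (poissonKernel T hT h) :=
  (poissonTerm_summable hT h).hasSum

theorem poissonKernel_adjoint_tmulH (hT : IsRowContraction T) (α : List (Fin n))
    (d : defectSpace T) :
    (poissonKernel T hT).adjoint (tmulH (fockBasis α) d) = wordOp T α (defect T d) := by
  refine ext_inner_right ℂ fun h => ?_
  rw [ContinuousLinearMap.adjoint_inner_left]
  have h1 := (hasSum_poissonKernel hT h).mapL (innerSL ℂ (tmulH (fockBasis α) d))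
  simp only [innerSL_apply_apply, poissonTerm, inner_tmulH, inner_fockBasis, fockBasis_apply] at h1
  have h2 := hasSum_single (f := fun β : List (Fin n) => (if α = β then (1 : ℂ) else 0) *
    ⟪d, defectVec T ((wordOp T β).adjoint h)⟫_ℂ) α fun β hβ => by simp [hβ.symm]
  rw [h1.unique h2, if_pos rfl, one_mul]
  change ⟪(d : H), defect T ((wordOp T α).adjoint h)⟫_ℂ = _
  rw [← ContinuousLinearMap.adjoint_inner_left, defect_adjoint,
    ContinuousLinearMap.adjoint_inner_right]

/-- `K_T*` intertwines `Sᵢ ⊗ I` and `Tᵢ`. -/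
theorem poissonKernel_adjoint_leftCreation (hT : IsRowContraction T) (i : Fin n) (φ : Fock n)
    (d : defectSpace T) :
    (poissonKernel T hT).adjoint (tmulH (leftCreation i φ) d) =
      T i ((poissonKernel T hT).adjoint (tmulH φ d)) := by
  suffices h : (poissonKernel T hT).adjoint ∘L tmulRight (Fock n) d ∘L leftCreation i =
      T i ∘L (poissonKernel T hT).adjoint ∘L tmulRight (Fock n) d from
    congrArg (fun A : Fock n →L[ℂ] H => A φ) h
  refine ext_fockBasis fun α => ?_
  simp [tmulRight_apply, leftCreation_fockBasis, poissonKernel_adjoint_tmulH, wordOp_cons]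

/-- Iterating `I = Δ_T² + ∑ Tᵢ Tᵢ*` over the words of length less than `k`. -/
theorem sum_wordsBelow_add (hT : IsRowContraction T) (k : ℕ) (h : H) :
    (∑ α ∈ wordsBelow n k, wordOp T α (defect T (defect T ((wordOp T α).adjoint h)))) +
      ∑ α : Fin k → Fin n, wordOp T (List.ofFn α) ((wordOp T (List.ofFn α)).adjoint h) = h := by
  induction k generalizing h with
  | zero =>
    simp only [wordsBelow, Finset.sum_empty, zero_add, List.ofFn_zero, wordOp_nil_adjoint]
    simp [wordOp_nil]
  | succ k ih =>
    rw [sum_wordsBelow_succ (fun α => wordOp T α (defect T (defect T ((wordOp T α).adjoint h)))),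
      sum_words_succ (fun α => wordOp T α ((wordOp T α).adjoint h)), add_assoc,
      ← Finset.sum_add_distrib]
    simp only [adjoint_wordOp_cons]
    simp only [wordOp_cons, ContinuousLinearMap.comp_apply, ← map_sum, ← map_add, ih]
    have := congrArg (fun A : H →L[ℂ] H => A h) hT.defect_mul_self
    simp only [mul_apply_eq_comp, sub_apply, sum_apply, one_apply_eq_self,
      ContinuousLinearMap.comp_apply] at this
    rw [wordOp_nil_adjoint, wordOp_nil, one_apply_eq_self, this]
    abel

/-- `∑_{|α| = k} T_α T_α*` converges strongly to `I - K_T* K_T`. -/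
theorem tendstoSOT_sum_wordOp (hT : IsRowContraction T) :
    TendstoSOT (fun k : ℕ => ∑ α : Fin k → Fin n,
        wordOp T (List.ofFn α) ∘L (wordOp T (List.ofFn α)).adjoint) atTop
      (ContinuousLinearMap.id ℂ H - (poissonKernel T hT).adjoint ∘L poissonKernel T hT) := by
  intro h
  have h1 := ((hasSum_poissonKernel hT h).mapL (poissonKernel T hT).adjoint).comp
    tendsto_wordsBelow
  have h2 := (tendsto_const_nhds (x := h)).sub h1
  refine h2.congr fun k => ?_
  rw [sub_eq_iff_eq_add']
  simp only [Function.comp_apply, poissonTerm, poissonKernel_adjoint_tmulH, sum_apply,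
    ContinuousLinearMap.comp_apply]
  exact (sum_wordsBelow_add hT k h).symm

theorem tendsto_sum_norm_sq_wordOp (hT : IsRowContraction T) (h : H) :
    Tendsto (fun k : ℕ => ∑ α : Fin k → Fin n, ‖(wordOp T (List.ofFn α)).adjoint h‖ ^ 2) atTop
      (𝓝 (‖h‖ ^ 2 - ‖poissonKernel T hT h‖ ^ 2)) := by
  have h1 : Tendsto (fun k => RCLike.re ⟪h, (∑ α : Fin k → Fin n,
      wordOp T (List.ofFn α) ∘L (wordOp T (List.ofFn α)).adjoint) h⟫_ℂ) atTop
      (𝓝 (RCLike.re ⟪h, (ContinuousLinearMap.id ℂ H -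
        (poissonKernel T hT).adjoint ∘L poissonKernel T hT) h⟫_ℂ)) :=
    (RCLike.continuous_re.tendsto _).comp (tendsto_const_nhds.inner (tendstoSOT_sum_wordOp hT h))
  convert h1 using 1
  · ext k
    simp only [sum_apply, inner_sum, ContinuousLinearMap.comp_apply, map_sum]
    refine Finset.sum_congr rfl fun α _ => ?_
    rw [← ContinuousLinearMap.adjoint_inner_left]
    exact (inner_self_eq_norm_sq _).symm
  · simp only [sub_apply, inner_sub_right, ContinuousLinearMap.comp_apply,
      ContinuousLinearMap.adjoint_inner_right, map_sub, inner_self_eq_norm_sq,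
      ContinuousLinearMap.id_apply]

/-- The Poisson kernel of a completely non-coisometric row contraction is injective. -/
theorem IsCNC.eq_zero_of_poissonKernel_eq_zero (hcnc : IsCNC T) (hT : IsRowContraction T) {h : H}
    (hh : poissonKernel T hT h = 0) : h = 0 := by
  by_contra h0
  refine hcnc ⟨h, h0, fun k _ => ?_⟩
  -- The sums decrease in `k`, start at `‖h‖ ^ 2`, and have the same limit.
  have hanti : Antitone fun k : ℕ =>
      ∑ α : Fin k → Fin n, ‖(wordOp T (List.ofFn α)).adjoint h‖ ^ 2 := by
    refine antitone_nat_of_succ_le fun k => ?_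
    clear hh h0
    induction k generalizing h with
    | zero =>
      refine (hT.sum_norm_sq_words_le 1 h).trans ?_
      simp [wordOp_nil_adjoint]
    | succ k ih =>
      rw [sum_words_succ (fun α => ‖(wordOp T α).adjoint h‖ ^ 2),
        sum_words_succ (fun α => ‖(wordOp T α).adjoint h‖ ^ 2)]
      simp only [adjoint_wordOp_cons]
      exact Finset.sum_le_sum fun i _ => ih
  have hlim := tendsto_sum_norm_sq_wordOp hT h
  rw [hh, norm_zero, zero_pow two_ne_zero, sub_zero] at hlim
  exact le_antisymm (hT.sum_norm_sq_words_le k h) (hanti.le_of_tendsto hlim k)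

/-! ### The von Neumann inequality and the functional calculus -/

theorem norm_poissonKernel_le (hT : IsRowContraction T) : ‖poissonKernel T hT‖ ≤ 1 :=
  LinearMap.mkContinuous_norm_le _ zero_le_one _

/-- The Poisson kernel of a strict contraction `rT` is isometric. -/
theorem poissonKernel_smul_adjoint_comp_self (hT : IsRowContraction T) {r : ℝ}
    (hr : r ∈ Set.Ioo (0 : ℝ) 1) :
    (poissonKernel _ (hT.smul hr)).adjoint ∘L poissonKernel _ (hT.smul hr) =
      ContinuousLinearMap.id ℂ H := by
  refine (ContinuousLinearMap.norm_map_iff_adjoint_comp_self _).1 ?_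
  intro h
  have h1 := tendsto_sum_norm_sq_wordOp (hT.smul hr) h
  have h2 : Tendsto (fun k : ℕ => (r ^ 2) ^ k * ‖h‖ ^ 2) atTop (𝓝 0) := by
    simpa using (tendsto_pow_atTop_nhds_zero_of_lt_one (sq_nonneg r)
      (pow_lt_one₀ hr.1.le hr.2 two_ne_zero)).mul_const (‖h‖ ^ 2)
  have h3 : Tendsto (fun k : ℕ => ∑ α : Fin k → Fin n,
      ‖(wordOp (fun i => (r : ℂ) • T i) (List.ofFn α)).adjoint h‖ ^ 2) atTop (𝓝 0) := by
    refine squeeze_zero (fun k => by positivity) (fun k => ?_) h2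
    calc _ = ∑ α : Fin k → Fin n, (r ^ 2) ^ k * ‖(wordOp T (List.ofFn α)).adjoint h‖ ^ 2 := by
          refine Finset.sum_congr rfl fun α _ => ?_
          rw [wordOp_smul, map_smulₛₗ, smul_apply, norm_smul, mul_pow,
            List.length_ofFn, RCLike.norm_conj, norm_pow, Complex.norm_real,
            Real.norm_of_nonneg hr.1.le, ← pow_mul, ← pow_mul, mul_comm k]
      _ ≤ _ := by
          rw [← Finset.mul_sum]
          gcongr
          exact hT.sum_norm_sq_words_le k h
  have h4 := tendsto_nhds_unique h1 h3
  exact (sq_eq_sq₀ (norm_nonneg _) (norm_nonneg _)).1 (by linarith)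

/-- The von Neumann inequality `‖f(rT)‖ ≤ ‖f‖`: the Poisson kernel `K` of `rT` is isometric and
`f(rT) = K* (f ⊗ I) K`. -/
theorem IsRowContraction.norm_tsum_radialTerm_le (hT : IsRowContraction T)
    {f : Fock n →L[ℂ] Fock n} (hf : f ∈ rightCommutant n) {r : ℝ}
    (hr : r ∈ Set.Ioo (0 : ℝ) 1) : ‖∑' k, radialTerm T f r k‖ ≤ ‖f‖ := by
  set A := ∑' k, radialTerm T f r k with hA
  set K := poissonKernel _ (hT.smul hr) with hK
  have h1 : K.adjoint ∘L tensorId _ f = A ∘L K.adjoint := by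
    refine ext_tmulH fun φ d => ?_
    suffices h : K.adjoint ∘L tmulRight (Fock n) d ∘L f =
        A ∘L K.adjoint ∘L tmulRight (Fock n) d by
      simpa [tensorId_tmulH, tmulRight_apply] using
        congrArg (fun B : Fock n →L[ℂ] H => B φ) h
    refine ext_fockBasis fun β => ?_
    have hL : ∀ i x, (K.adjoint ∘L tmulRight (Fock n) d) (leftCreation i x) =
        ((r : ℂ) • T i) ((K.adjoint ∘L tmulRight (Fock n) d) x) := fun i x =>
      poissonKernel_adjoint_leftCreation (hT.smul hr) i x d
    have h2 := hasSum_by_length ((hasSum_rightCommutant_fockBasis hf β).mapL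
      (K.adjoint ∘L tmulRight (Fock n) d))
    have h3 := (hT.summable_radialTerm f hr).hasSum.mapL
      (ContinuousLinearMap.apply ℂ H ((K.adjoint ∘L tmulRight (Fock n) d) (fockBasis β)))
    refine h2.unique ?_
    change HasSum _ (A ((K.adjoint ∘L tmulRight (Fock n) d) (fockBasis β))) at h3
    refine (congrArg (fun F => HasSum F _) ?_).mpr h3
    funext k
    rw [radialTerm_eq, ContinuousLinearMap.apply_apply, sum_apply]
    simp only [map_smul, map_wordOp hL, smul_apply]
  have h2 : A = K.adjoint ∘L tensorId _ f ∘L K := by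
    rw [← ContinuousLinearMap.comp_assoc, h1, ContinuousLinearMap.comp_assoc,
      poissonKernel_smul_adjoint_comp_self hT hr, ContinuousLinearMap.comp_id]
  have hK1 : ‖K‖ ≤ 1 := norm_poissonKernel_le _
  rw [h2]
  calc ‖K.adjoint ∘L tensorId _ f ∘L K‖ ≤ ‖K.adjoint‖ * (‖tensorId _ f‖ * ‖K‖) :=
        (ContinuousLinearMap.opNorm_comp_le _ _).trans
          (by gcongr; exact ContinuousLinearMap.opNorm_comp_le _ _)
    _ ≤ 1 * (‖f‖ * 1) := by
        rw [LinearIsometryEquiv.norm_map]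
        gcongr
        exact norm_tensorId_le f
    _ = ‖f‖ := by ring

theorem eventually_mem_Ioo : ∀ᶠ r : ℝ in 𝓝[<] 1, r ∈ Set.Ioo (0 : ℝ) 1 :=
  Ioo_mem_nhdsLT zero_lt_one

/-- An operator in the commutant of the right creation operators is the strong limit of its
radial means: `f(S₁, …, Sₙ) = f`. -/
theorem hasFunctionalCalculus_leftCreation {f : Fock n →L[ℂ] Fock n} (hf : f ∈ rightCommutant n) :
    HasFunctionalCalculus leftCreation f f := by
  refine ⟨fun r hr => isRowContraction_leftCreation.summable_radialTerm f hr, ?_⟩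
  refine tendsto_apply_of_total (C := ‖f‖) (eventually_mem_Ioo.mono fun r hr =>
    isRowContraction_leftCreation.norm_tsum_radialTerm_le hf hr) f
    eq_zero_of_forall_inner_fockBasis ?_
  rintro _ ⟨β, rfl⟩
  set c : ℝ → Set.Icc (0 : ℝ) 1 := fun r => Set.projIcc 0 1 zero_le_one r with hc
  have hc1 : Tendsto (fun r => (((c r : ℝ)) : ℂ)) (𝓝[<] 1) (𝓝 1) := by
    have : Continuous fun r => (((c r : ℝ)) : ℂ) := by fun_prop
    have h1 := this.tendsto 1
    simp only [hc, Set.projIcc_right] at h1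
    exact (by simpa using h1 : Tendsto (fun r => (((c r : ℝ)) : ℂ)) (𝓝 1) (𝓝 1)).mono_left
      nhdsWithin_le_nhds
  -- The dilation tends strongly to the identity, and `r ^ |β| f_r(S) e_β` is the dilated `f e_β`.
  have hD : Tendsto (fun r => dilation n (c r) (f (fockBasis β))) (𝓝[<] 1)
      (𝓝 (f (fockBasis β))) := by
    refine tendsto_apply_of_total (A := fun r => dilation n (c r)) (C := 1)
      (Eventually.of_forall fun r => norm_dilation_le _) (ContinuousLinearMap.id ℂ _)
      eq_zero_of_forall_inner_fockBasis ?_ _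
    rintro _ ⟨α, rfl⟩
    simp only [dilation_fockBasis, ContinuousLinearMap.id_apply]
    simpa using (hc1.pow α.length).smul_const (fockBasis α)
  have hinv : Tendsto (fun r => ((((c r : ℝ)) : ℂ) ^ β.length)⁻¹) (𝓝[<] 1) (𝓝 1) := by
    simpa using (hc1.pow β.length).inv₀ (by simp)
  have hlim := hinv.smul hD
  rw [one_smul] at hlim
  refine hlim.congr' (eventually_mem_Ioo.mono fun r hr => ?_)
  have hcr : (c r : ℝ) = r := by
    rw [hc]
    simp only [Set.projIcc_of_mem zero_le_one (Set.Ioo_subset_Icc_self hr)]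
  have hr0 : (r : ℂ) ≠ 0 := by exact_mod_cast hr.1.ne'
  rw [inv_smul_eq_iff₀ (by rw [hcr]; exact pow_ne_zero _ hr0)]
  have h1 := hasSum_by_length ((hasSum_rightCommutant_fockBasis hf β).mapL (dilation n (c r)))
  have h2 := ((isRowContraction_leftCreation.summable_radialTerm f hr).hasSum.mapL
    (ContinuousLinearMap.apply ℂ _ (fockBasis β))).const_smul ((r : ℂ) ^ β.length)
  rw [hcr]
  refine h1.unique ?_
  change HasSum _ ((r : ℂ) ^ β.length • (∑' k, radialTerm leftCreation f r k) (fockBasis β)) at h2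
  convert h2 using 1
  funext k
  simp only [radialTerm, ContinuousLinearMap.apply_apply, sum_apply, smul_apply, map_smul,
    wordOp_leftCreation_fockBasis, dilation_fockBasis, Finset.smul_sum, smul_smul, hcr,
    List.length_append, List.length_ofFn, pow_add]
  refine Finset.sum_congr rfl fun α _ => ?_
  congr 1
  ring

theorem isWOTClosed_setOf_comp_eq {E : Type*} [NormedAddCommGroup E] [InnerProductSpace ℂ E]
    [CompleteSpace E] (R : E →L[ℂ] E) : IsWOTClosed {A : E →L[ℂ] E | R * A = A * R} := by
  have hcont (x y : E) : Continuous fun A : E →WOT[ℂ] E => ⟪y, A x⟫_ℂ :=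
    ContinuousLinearMapWOT.continuous_iff.1 continuous_id x y
  have : IsClosed (⋂ x, ⋂ y, {A : E →WOT[ℂ] E | ⟪R.adjoint y, A x⟫_ℂ = ⟪y, A (R x)⟫_ℂ}) :=
    isClosed_iInter fun x => isClosed_iInter fun y => isClosed_eq (hcont _ _) (hcont _ _)
  rw [IsWOTClosed]
  convert this using 1
  ext A
  simp only [Set.mem_preimage, Set.mem_ofPred_eq, Set.mem_iInter,
    ContinuousLinearMap.adjoint_inner_left]
  refine ⟨fun h x y => congrArg (fun B : E →L[ℂ] E => ⟪y, B x⟫_ℂ) h, fun h => ?_⟩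
  ext x
  exact ext_inner_left ℂ fun y => h x y

theorem IsWOTClosed.mem_of_tendstoSOT {E ι : Type*} [NormedAddCommGroup E]
    [InnerProductSpace ℂ E] [CompleteSpace E] {s : Set (E →L[ℂ] E)} (hs : IsWOTClosed s)
    {A : ι → E →L[ℂ] E} {l : Filter ι} [l.NeBot] {Q : E →L[ℂ] E} (hA : TendstoSOT A l Q)
    (hmem : ∀ᶠ i in l, A i ∈ s) : Q ∈ s :=
  IsClosed.mem_of_tendsto (x := ContinuousLinearMapWOT.ofCLM Q)
    (f := fun i => ContinuousLinearMapWOT.ofCLM (A i)) hs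
    (ContinuousLinearMapWOT.tendsto_iff_forall_inner_apply_tendsto.2 fun x _ =>
      tendsto_const_nhds.inner (hA x)) hmem

/-- `Fₙ^∞` is the commutant of the right creation operators. -/
theorem toeplitzAlgebra_eq_rightCommutant : toeplitzAlgebra n = rightCommutant n := by
  apply le_antisymm
  · refine sInf_le ⟨leftCreation_mem_rightCommutant, ?_⟩
    have h : ((rightCommutant n : Set (Fock n →L[ℂ] Fock n))) =
        ⋂ i, {A | rightCreation i * A = A * rightCreation i} := by
      ext A
      simp [rightCommutant, Set.mem_centralizer_iff]
    rw [h, IsWOTClosed, Set.preimage_iInter]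
    exact isClosed_iInter fun i => isWOTClosed_setOf_comp_eq _
  · refine le_sInf fun A hA f hf => ?_
    obtain ⟨hsum, hlim⟩ := hasFunctionalCalculus_leftCreation hf
    refine IsWOTClosed.mem_of_tendstoSOT hA.2 hlim (eventually_mem_Ioo.mono fun r hr => ?_)
    refine IsWOTClosed.mem_of_tendstoSOT (l := atTop)
      (A := fun s : Finset ℕ => ∑ k ∈ s, radialTerm leftCreation f r k) hA.2
      (fun h => by
        simpa [sum_apply, HasSum] using
          (hsum r hr).hasSum.mapL (ContinuousLinearMap.apply ℂ _ h))
      (Eventually.of_forall fun s => ?_)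
    exact A.sum_mem fun k _ => A.sum_mem fun α _ => A.smul_mem (wordOp_mem hA.1 _) _

end Poisson

/-! ### Contractive colligations -/

section Colligation

/-- If `‖b h‖ ≤ ‖a h‖` for all `h`, then `b = U a` for a contraction `U` (Douglas factorization). -/
theorem exists_contraction_factor {M P Q : Type*} [AddCommGroup M] [Module ℂ M]
    [NormedAddCommGroup P] [InnerProductSpace ℂ P] [CompleteSpace P] [NormedAddCommGroup Q]
    [InnerProductSpace ℂ Q] [CompleteSpace Q] (a : M →ₗ[ℂ] P) (b : M →ₗ[ℂ] Q)
    (hab : ∀ h, ‖b h‖ ≤ ‖a h‖) :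
    ∃ U : P →L[ℂ] Q, (∀ h, U (a h) = b h) ∧ ∀ p, ‖U p‖ ≤ ‖p‖ := by
  set K := (LinearMap.range a).topologicalClosure with hK
  have : CompleteSpace K := (LinearMap.range a).isClosed_topologicalClosure.completeSpace_coe
  have haK : ∀ h, a h ∈ K := fun h => Submodule.le_topologicalClosure _ ⟨h, rfl⟩
  let e : M →ₗ[ℂ] K := a.codRestrict K haK
  have hdense : DenseRange e := by
    intro y
    rw [Topology.IsEmbedding.subtypeVal.closure_eq_preimage_closure_image, ← Set.range_comp]
    exact y.2
  have hnorm : ∀ h, ‖b h‖ ≤ 1 * ‖e h‖ := fun h => (hab h).trans_eq (one_mul _).symm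
  refine ⟨(b.extendOfNorm e) ∘L K.orthogonalProjectionOnto, fun h => ?_, fun p => ?_⟩
  · have : K.orthogonalProjectionOnto (a h) = e h :=
      Submodule.orthogonalProjectionOnto_mem_subspace_eq_self (e h)
    rw [ContinuousLinearMap.comp_apply, this]
    exact LinearMap.extendOfNorm_eq hdense ⟨1, hnorm⟩ h
  · refine (LinearMap.norm_extendOfNorm_apply_le hdense 1 hnorm _).trans ?_
    rw [one_mul]
    exact K.norm_orthogonalProjectionOnto_apply_le p

/-- A contraction `Eⁿ ⊕ ℂ → E ⊕ ℂ` in block form that carries `(u h, w h)` to `(u' h, w' h)`. -/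
theorem exists_contractive_colligation {n : ℕ} {M E : Type*} [AddCommGroup M] [Module ℂ M]
    [NormedAddCommGroup E] [InnerProductSpace ℂ E] [CompleteSpace E]
    (u : Fin n → M →ₗ[ℂ] E) (w : M →ₗ[ℂ] ℂ) (u' : M →ₗ[ℂ] E) (w' : M →ₗ[ℂ] ℂ)
    (h : ∀ x, ‖u' x‖ ^ 2 + ‖w' x‖ ^ 2 ≤ ∑ i, ‖u i x‖ ^ 2 + ‖w x‖ ^ 2) :
    ∃ (A : Fin n → E →L[ℂ] E) (b : E) (c : Fin n → E →L[ℂ] ℂ) (d : ℂ),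
      (∀ x, u' x = ∑ i, A i (u i x) + w x • b) ∧
      (∀ x, w' x = ∑ i, c i (u i x) + w x • d) ∧
      ∀ (y : Fin n → E) (z : ℂ), ‖∑ i, A i (y i) + z • b‖ ^ 2 + ‖∑ i, c i (y i) + z • d‖ ^ 2 ≤
        ∑ i, ‖y i‖ ^ 2 + ‖z‖ ^ 2 := by
  let iP : ((Fin n → E) × ℂ) ≃L[ℂ] WithLp 2 (PiLp 2 (fun _ : Fin n => E) × ℂ) :=
    ((PiLp.continuousLinearEquiv 2 ℂ (fun _ : Fin n => E)).symm.prodCongr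
      (ContinuousLinearEquiv.refl ℂ ℂ)).trans (WithLp.prodContinuousLinearEquiv 2 ℂ _ _).symm
  let iQ : (E × ℂ) ≃L[ℂ] WithLp 2 (E × ℂ) := (WithLp.prodContinuousLinearEquiv 2 ℂ _ _).symm
  have nP (p : (Fin n → E) × ℂ) : ‖iP p‖ ^ 2 = ∑ i, ‖p.1 i‖ ^ 2 + ‖p.2‖ ^ 2 := by
    rw [WithLp.prod_norm_sq_eq_of_L2]
    congr 1
    exact PiLp.norm_sq_eq_of_L2 _ _
  have nQ (q : E × ℂ) : ‖iQ q‖ ^ 2 = ‖q.1‖ ^ 2 + ‖q.2‖ ^ 2 := WithLp.prod_norm_sq_eq_of_L2 _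
  obtain ⟨U, hU, hUle⟩ := exists_contraction_factor
    (iP.toLinearEquiv.toLinearMap ∘ₗ (LinearMap.pi u).prod w)
    (iQ.toLinearEquiv.toLinearMap ∘ₗ u'.prod w') fun x => by
      refine (sq_le_sq₀ (norm_nonneg _) (norm_nonneg _)).1 ?_
      exact (nQ (u' x, w' x)).trans_le ((h x).trans_eq (nP (fun i => u i x, w x)).symm)
  let V : ((Fin n → E) × ℂ) →L[ℂ] E × ℂ := iQ.symm.toContinuousLinearMap ∘L U ∘L
    iP.toContinuousLinearMap
  have hV (x : M) : V (fun i => u i x, w x) = (u' x, w' x) := by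
    have := hU x
    exact (congrArg iQ.symm this).trans (iQ.symm_apply_apply _)
  have hVle (p : (Fin n → E) × ℂ) : ‖(V p).1‖ ^ 2 + ‖(V p).2‖ ^ 2 ≤ ∑ i, ‖p.1 i‖ ^ 2 + ‖p.2‖ ^ 2 := by
    rw [← nQ, ← nP]
    have : iQ (V p) = U (iP p) := iQ.apply_symm_apply _
    rw [this]
    exact pow_le_pow_left₀ (norm_nonneg _) (hUle _) 2
  let j (i : Fin n) : E →L[ℂ] (Fin n → E) × ℂ :=
    ContinuousLinearMap.inl ℂ _ _ ∘L ContinuousLinearMap.single ℂ (fun _ : Fin n => E) i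
  have hdec (y : Fin n → E) (z : ℂ) : V (y, z) = ∑ i, V (j i (y i)) + z • V (0, 1) := by
    rw [← map_sum, ← map_smul, ← map_add]
    congr 1
    refine Prod.ext ?_ ?_
    · funext k
      simp [j, Prod.fst_sum]
    · simp [j, Prod.snd_sum]
  have h1 (y : Fin n → E) (z : ℂ) : (V (y, z)).1 = ∑ i, (V (j i (y i))).1 + z • (V (0, 1)).1 := by
    rw [hdec]; simp [Prod.fst_sum]
  have h2 (y : Fin n → E) (z : ℂ) : (V (y, z)).2 = ∑ i, (V (j i (y i))).2 + z • (V (0, 1)).2 := by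
    rw [hdec]; simp [Prod.snd_sum]
  refine ⟨fun i => ContinuousLinearMap.fst ℂ _ _ ∘L V ∘L j i, (V (0, 1)).1,
    fun i => ContinuousLinearMap.snd ℂ _ _ ∘L V ∘L j i, (V (0, 1)).2, fun x => ?_, fun x => ?_,
    fun y z => ?_⟩
  · exact (congrArg Prod.fst (hV x)).symm.trans (h1 _ _)
  · exact (congrArg Prod.snd (hV x)).symm.trans (h2 _ _)
  · exact (congrArg₂ (fun a b => ‖a‖ ^ 2 + ‖b‖ ^ 2) (h1 y z) (h2 y z)).symm.trans_le (hVle (y, z))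

/-- A row contraction `Eⁿ ⊕ ℂ → E` has a contractive adjoint. -/
theorem norm_sq_adjoint_row_le {n : ℕ} {E : Type*} [NormedAddCommGroup E] [InnerProductSpace ℂ E]
    [CompleteSpace E] {A : Fin n → E →L[ℂ] E} {b : E}
    (h : ∀ (y : Fin n → E) (z : ℂ), ‖∑ i, A i (y i) + z • b‖ ^ 2 ≤ ∑ i, ‖y i‖ ^ 2 + ‖z‖ ^ 2)
    (x : E) : ‖innerSL ℂ b x‖ ^ 2 + ∑ i, ‖(A i).adjoint x‖ ^ 2 ≤ ‖x‖ ^ 2 := by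
  rw [innerSL_apply_apply]
  set t := ∑ i, ‖(A i).adjoint x‖ ^ 2 + ‖⟪b, x⟫_ℂ‖ ^ 2 with ht
  have h1 := h (fun i => (A i).adjoint x) ⟪b, x⟫_ℂ
  set y := ∑ i, A i ((A i).adjoint x) + ⟪b, x⟫_ℂ • b with hy
  have h2 : ⟪y, x⟫_ℂ = (t : ℂ) := by
    rw [hy, inner_add_left, sum_inner, inner_smul_left, Complex.conj_mul', ht]
    push_cast
    congr 1
    refine Finset.sum_congr rfl fun i _ => ?_
    rw [← ContinuousLinearMap.adjoint_inner_right]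
    exact inner_self_eq_norm_sq_to_K _
  have ht0 : 0 ≤ t := by positivity
  have h3 : t ≤ ‖y‖ * ‖x‖ := by
    have := norm_inner_le_norm (𝕜 := ℂ) y x
    rwa [h2, Complex.norm_real, Real.norm_of_nonneg ht0] at this
  nlinarith [sq_nonneg (‖y‖ - ‖x‖)]

end Colligation

/-! ### Lifting of operators commuting with the compressed right creation operators -/

section Lifting

variable {n : ℕ}

/-- A Lyapunov inequality `f + ∑ g ∘ pᵢ ≤ g` bounds the sums of `f` along the tree of words. -/
theorem sum_foldl_le {X : Type*} (p : Fin n → X → X) {f g : X → ℝ} (hg : ∀ x, 0 ≤ g x)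
    (h : ∀ x, f x + ∑ i, g (p i x) ≤ g x) (m : ℕ) (x : X) :
    ∑ α ∈ wordsBelow n m, f (α.foldl (fun y i => p i y) x) ≤ g x := by
  induction m generalizing x with
  | zero => simpa [wordsBelow] using hg x
  | succ m ih =>
    rw [sum_wordsBelow_succ]
    simp only [List.foldl_cons, List.foldl_nil]
    exact le_trans (by gcongr; exact ih _) (h x)

/-- The operator into the full Fock space whose coordinate at the word `i₁ ⋯ iₖ` is
`c (C_{i₁} ⋯ C_{iₖ} x)`: the last letter acts first, as the adjoints of the right creation operators
strip letters from the right. It is contractive if `c` and `C` satisfy a Lyapunov inequality. -/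
theorem exists_observability_operator {E : Type*} [NormedAddCommGroup E] [InnerProductSpace ℂ E]
    (C : Fin n → E →L[ℂ] E) (c : E →L[ℂ] ℂ) (g : E → ℝ) (hg : ∀ x, 0 ≤ g x)
    (hg' : ∀ x, g x ≤ ‖x‖ ^ 2) (h : ∀ x, ‖c x‖ ^ 2 + ∑ i, g (C i x) ≤ g x) :
    ∃ O : E →L[ℂ] Fock n, ‖O‖ ≤ 1 ∧ (∀ x, O x [] = c x) ∧
      ∀ i x, (rightCreation i).adjoint (O x) = O (C i x) := by
  -- The first letter of `α` acts first in `W α`, so words are reversed below.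
  let W (α : List (Fin n)) : E →ₗ[ℂ] E :=
    α.foldr (fun i B => B ∘ₗ (C i).toLinearMap) LinearMap.id
  have hW (α : List (Fin n)) (x : E) : W α x = α.foldl (fun y i => C i y) x := by
    induction α generalizing x with
    | nil => rfl
    | cons i α ih => exact ih (C i x)
  have hle (x : E) (s : Finset (List (Fin n))) : ∑ α ∈ s, ‖c (W α x)‖ ^ 2 ≤ ‖x‖ ^ 2 := by
    have h1 : s ⊆ wordsBelow n (s.sup List.length + 1) := fun α hα =>
      mem_wordsBelow _ _ (Nat.lt_succ_of_le (Finset.le_sup (f := List.length) hα))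
    refine (Finset.sum_le_sum_of_subset_of_nonneg h1 fun _ _ _ => sq_nonneg _).trans ?_
    simp only [hW]
    exact (sum_foldl_le (fun i => C i) (f := fun x => ‖c x‖ ^ 2) hg h _ x).trans (hg' x)
  have hsum (x : E) : Summable fun α : List (Fin n) => ‖c (W α.reverse x)‖ ^ 2 :=
    (List.reverse_involutive.toPerm List.reverse).summable_iff.2
      (summable_of_sum_le (fun _ => sq_nonneg _) (hle x))
  have hmem (x : E) : Memℓp (E := fun _ : List (Fin n) => ℂ) (fun α => c (W α.reverse x)) 2 :=
    memℓp_gen (by simpa using hsum x)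
  have hnorm (x : E) : ‖(⟨_, hmem x⟩ : Fock n)‖ ≤ 1 * ‖x‖ := by
    rw [one_mul]
    refine (sq_le_sq₀ (norm_nonneg _) (norm_nonneg _)).1 ?_
    have h1 : HasSum (fun α : List (Fin n) => ‖c (W α.reverse x)‖ ^ 2) _ :=
      hasSum_norm_sq_coord (⟨_, hmem x⟩ : Fock n)
    have h2 := (List.reverse_involutive.toPerm List.reverse).hasSum_iff
      (f := fun α => ‖c (W α x)‖ ^ 2) |>.1 h1
    exact hasSum_le_of_sum_le h2 (hle x)
  refine ⟨LinearMap.mkContinuous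
    { toFun := fun x => (⟨_, hmem x⟩ : Fock n)
      map_add' := fun x y => ?_
      map_smul' := fun a x => ?_ } 1 hnorm,
    LinearMap.mkContinuous_norm_le _ zero_le_one _, fun x => rfl, fun i x => ?_⟩
  · ext α
    exact (congrArg c (map_add _ _ _)).trans (map_add _ _ _)
  · ext α
    exact (congrArg c (map_smul _ _ _)).trans (map_smul _ _ _)
  · ext α
    rw [rightCreation_adjoint_apply]
    change c (W (α ++ [i]).reverse x) = c (W α.reverse (C i x))
    rw [List.reverse_append]
    rfl

/-- A functional bounded by a multiple of `‖h‖²` that does not increase under the shifts is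
nonpositive: only the coordinates of `h` at long words contribute to its bound. -/
theorem nonpos_of_le_sum_shift {X : Type*} (ι : X → Fock n) (C : Fin n → X → X)
    (hC : ∀ i x, ι (C i x) = (rightCreation i).adjoint (ι x)) (g : X → ℝ) (M : ℝ)
    (hg : ∀ x, g x ≤ ∑ i, g (C i x)) (hM : ∀ x, g x ≤ M * ‖ι x‖ ^ 2) (x : X) : g x ≤ 0 := by
  have key (m : ℕ) (x : X) :
      g x ≤ M * (‖ι x‖ ^ 2 - ∑ α ∈ wordsBelow n m, ‖ι x α.reverse‖ ^ 2) := by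
    induction m generalizing x with
    | zero => simpa [wordsBelow] using hM x
    | succ m ih =>
      refine (hg x).trans ((Finset.sum_le_sum fun i _ => ih (C i x)).trans_eq ?_)
      rw [sum_wordsBelow_succ (fun α => ‖ι x α.reverse‖ ^ 2), norm_sq_eq_vacuum_add_rightCreation,
        ← Finset.mul_sum, Finset.sum_sub_distrib]
      simp only [hC, rightCreation_adjoint_apply, List.reverse_cons, List.reverse_nil]
      ring
  have h1 : HasSum (fun α : List (Fin n) => ‖ι x α.reverse‖ ^ 2) (‖ι x‖ ^ 2) :=
    (List.reverse_involutive.toPerm List.reverse).hasSum_iff.2 (hasSum_norm_sq_coord (ι x))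
  have h2 := ((tendsto_const_nhds (x := ‖ι x‖ ^ 2)).sub (h1.comp tendsto_wordsBelow)).const_mul M
  rw [sub_self, mul_zero] at h2
  exact ge_of_tendsto' h2 fun m => key m x

/-- The extension theorem for contractions on a Hilbert space `E` that is embedded in the Fock space
by an isometry `ι` whose range is invariant under the adjoints of the right creation operators.

With `G = (I - Z* Z)^{1/2}` the quantity `‖G h‖² + |(Z h)_∅|²` equals `∑ ‖G (Cᵢ h)‖² + |h_∅|²`. A
contractive colligation realizing this identity defines the vacuum coordinate of the extension on
the whole Fock space; the other coordinates follow from the commutation relations. -/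
theorem exists_lift_of_norm_le_one {E : Type*} [NormedAddCommGroup E] [InnerProductSpace ℂ E]
    [CompleteSpace E] (ι : E →ₗᵢ[ℂ] Fock n)
    (C : Fin n → E →L[ℂ] E) (hC : ∀ i h, ι (C i h) = (rightCreation i).adjoint (ι h))
    (Z : E →L[ℂ] E) (hZ1 : ‖Z‖ ≤ 1) (hZ : ∀ i h, Z (C i h) = C i (Z h)) :
    ∃ Y : Fock n →L[ℂ] Fock n,
      (∀ i h, (rightCreation i).adjoint (Y h) = Y ((rightCreation i).adjoint h)) ∧
      ∀ h : E, Y (ι h) = ι (Z h) := by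
  -- The operator `G`, seen as the defect operator of the row contraction `[Z*]`.
  have hrow : IsRowContraction fun _ : Fin 1 => Z.adjoint :=
    isRowContraction_of_sum_norm_sq_le fun x => by
      have : ‖Z x‖ ≤ ‖x‖ := (Z.le_opNorm x).trans (mul_le_of_le_one_left (norm_nonneg x) hZ1)
      simpa using pow_le_pow_left₀ (norm_nonneg _) this 2
  obtain ⟨G, hGn⟩ : ∃ G : E →L[ℂ] E, ∀ h, ‖G h‖ ^ 2 + ‖Z h‖ ^ 2 = ‖h‖ ^ 2 :=
    ⟨defect fun _ : Fin 1 => Z.adjoint, fun h => by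
      simpa [defectVec] using norm_sq_defect hrow h⟩
  have hsplit (h : E) : ‖h‖ ^ 2 = ‖ι h []‖ ^ 2 + ∑ i, ‖C i h‖ ^ 2 := by
    simpa only [← hC, ι.norm_map] using norm_sq_eq_vacuum_add_rightCreation (ι h)
  obtain ⟨v, hv⟩ : ∃ v : E →ₗ[ℂ] ℂ, ∀ h, v h = ι h [] :=
    ⟨(innerSL ℂ (fockBasis [])).toLinearMap ∘ₗ ι.toLinearMap, fun h => inner_fockBasis [] _⟩
  obtain ⟨A, b, c, d, hGA, hZc, hle⟩ := exists_contractive_colligation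
    (fun i => (G ∘L C i).toLinearMap) v G.toLinearMap (v ∘ₗ Z.toLinearMap) fun h => by
      have h1 := hsplit h
      have h2 := hsplit (Z h)
      have h3 : ∑ i, ‖C i h‖ ^ 2 = ∑ i, ‖G (C i h)‖ ^ 2 + ∑ i, ‖C i (Z h)‖ ^ 2 := by
        rw [← Finset.sum_add_distrib]
        exact Finset.sum_congr rfl fun i _ => by rw [← hGn (C i h), hZ]
      have h4 := hGn h
      simp only [LinearMap.comp_apply, ContinuousLinearMap.coe_coe, hv,
        ContinuousLinearMap.comp_apply]
      linarith
  simp only [LinearMap.comp_apply, ContinuousLinearMap.coe_coe, hv,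
    ContinuousLinearMap.comp_apply] at hGA hZc
  obtain ⟨O, hO1, hOv, hOC⟩ := exists_observability_operator (fun i => (A i).adjoint) (innerSL ℂ b)
    (fun x => ‖x‖ ^ 2) (fun x => sq_nonneg _) (fun x => le_rfl)
    (norm_sq_adjoint_row_le fun y z => (le_add_of_nonneg_right (sq_nonneg _)).trans (hle y z))
  obtain ⟨Γ, hΓ⟩ : ∃ Γ, Γ = O.adjoint := ⟨_, rfl⟩
  have hΓ1 (h : Fock n) : ‖Γ h‖ ≤ ‖h‖ :=
    (Γ.le_opNorm h).trans (mul_le_of_le_one_left (norm_nonneg h)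
      (by rw [hΓ, LinearIsometryEquiv.norm_map]; exact hO1))
  have hΓA (h : Fock n) : Γ h = ∑ i, A i (Γ ((rightCreation i).adjoint h)) + h [] • b := by
    refine ext_inner_left ℂ fun x => ?_
    have e1 : ⟪x, Γ h⟫_ℂ = ⟪O x, h⟫_ℂ := by rw [hΓ, ContinuousLinearMap.adjoint_inner_right]
    have e2 : ⟪O x, fockBasis []⟫_ℂ = ⟪x, b⟫_ℂ := by
      rw [← inner_conj_symm, inner_fockBasis, hOv, innerSL_apply_apply, inner_conj_symm]
    have e3 (i : Fin n) : ⟪O x, rightCreation i ((rightCreation i).adjoint h)⟫_ℂ =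
        ⟪x, A i (Γ ((rightCreation i).adjoint h))⟫_ℂ := by
      rw [← ContinuousLinearMap.adjoint_inner_left, hOC, hΓ,
        ← ContinuousLinearMap.adjoint_inner_right O, ContinuousLinearMap.adjoint_inner_left]
    have e4 := congrArg (fun k => ⟪O x, k⟫_ℂ) (eq_vacuum_add_rightCreation h)
    simp only [inner_add_right, inner_sum, inner_smul_right, e2, e3] at e4
    rw [e1, e4, inner_add_right, inner_sum, inner_smul_right, add_comm]
  obtain ⟨Λ, hΛ⟩ : ∃ Λ : Fock n →L[ℂ] ℂ,
      ∀ h, Λ h = ∑ i, c i (Γ ((rightCreation i).adjoint h)) + h [] • d :=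
    ⟨∑ i, c i ∘L Γ ∘L (rightCreation i).adjoint + d • innerSL ℂ (fockBasis []), fun h => by
      simp [sum_apply, inner_fockBasis, mul_comm]⟩
  obtain ⟨Y, -, hYv, hYR⟩ := exists_observability_operator (fun i => (rightCreation i).adjoint) Λ
    (fun h => ‖h‖ ^ 2 - ‖Γ h‖ ^ 2)
    (fun h => sub_nonneg.2 (pow_le_pow_left₀ (norm_nonneg _) (hΓ1 h) 2))
    (fun h => sub_le_self _ (sq_nonneg _)) fun h => by
      have h1 := hle (fun i => Γ ((rightCreation i).adjoint h)) (h [])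
      rw [← hΓA, ← hΛ] at h1
      have h2 := norm_sq_eq_vacuum_add_rightCreation h
      rw [Finset.sum_sub_distrib]
      linarith
  refine ⟨Y, hYR, ?_⟩
  -- On `E` the operator `Γ` agrees with `G`, since both satisfy the same recursion.
  have hΓG (h : E) : G h = Γ (ι h) := by
    have h0 := nonpos_of_le_sum_shift ι (fun i => C i) hC
      (fun h => ‖G h - Γ (ι h)‖ ^ 2) (‖G - Γ ∘L ι.toContinuousLinearMap‖ ^ 2) (fun h => ?_)
      (fun h => ?_) h
    · exact sub_eq_zero.1 (norm_eq_zero.1 (pow_eq_zero_iff two_ne_zero |>.1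
        (le_antisymm h0 (sq_nonneg _))))
    · have h1 := hle (fun i => G (C i h) - Γ (ι (C i h))) 0
      have h2 : G h - Γ (ι h) = ∑ i, A i (G (C i h) - Γ (ι (C i h))) := by
        rw [hGA h, hΓA (ι h)]
        simp [hC]
      rw [zero_smul, add_zero, ← h2] at h1
      simp only [norm_zero] at h1
      linarith [sq_nonneg ‖∑ i, c i (G (C i h) - Γ (ι (C i h))) + (0 : ℂ) • d‖]
    · rw [ι.norm_map, ← mul_pow]
      exact pow_le_pow_left₀ (norm_nonneg _)
        ((G - Γ ∘L ι.toContinuousLinearMap).le_opNorm h) 2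
  have key (α : List (Fin n)) : ∀ h : E, Y (ι h) α = ι (Z h) α := by
    induction α using List.reverseRecOn with
    | nil =>
      intro h
      rw [hYv, hΛ, hZc]
      simp only [hΓG, hC]
    | append_singleton α i ih =>
      intro h
      rw [← rightCreation_adjoint_apply, ← rightCreation_adjoint_apply, hYR, ← hC, ← hC, ih, hZ]
  intro h
  ext α
  exact key α h

/-- Every operator on a subspace invariant under the adjoints of the right creation operators that
commutes with their restrictions extends to an operator on the Fock space that commutes with
them. This is the commutant lifting theorem for the full Fock space, up to taking adjoints and
without the norm estimate. -/
theorem exists_lift {E : Type*} [NormedAddCommGroup E] [InnerProductSpace ℂ E]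
    [CompleteSpace E] (ι : E →ₗᵢ[ℂ] Fock n)
    (C : Fin n → E →L[ℂ] E) (hC : ∀ i h, ι (C i h) = (rightCreation i).adjoint (ι h))
    (Z : E →L[ℂ] E) (hZ : ∀ i h, Z (C i h) = C i (Z h)) :
    ∃ Y : Fock n →L[ℂ] Fock n,
      (∀ i h, (rightCreation i).adjoint (Y h) = Y ((rightCreation i).adjoint h)) ∧
      ∀ h : E, Y (ι h) = ι (Z h) := by
  have hpos : 0 < ‖Z‖ + 1 := by positivity
  have hne : ((‖Z‖ + 1 : ℝ) : ℂ) ≠ 0 := by exact_mod_cast hpos.ne'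
  obtain ⟨Y, hYR, hYZ⟩ := exists_lift_of_norm_le_one ι C hC (((‖Z‖ + 1 : ℝ) : ℂ)⁻¹ • Z) (by
      rw [norm_smul, norm_inv, Complex.norm_real, Real.norm_of_nonneg hpos.le,
        inv_mul_le_one₀ hpos]
      linarith) fun i h => by rw [smul_apply, smul_apply, map_smul, hZ]
  refine ⟨((‖Z‖ + 1 : ℝ) : ℂ) • Y, fun i h => by rw [smul_apply, smul_apply, map_smul, hYR],
    fun h => ?_⟩
  rw [smul_apply, hYZ, smul_apply, map_smul, smul_inv_smul₀ hne]

end Lifting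

/-! ### Compressions to the constrained space -/

section Compression

variable {n : ℕ} (J : TwoSidedIdeal (toeplitzAlgebra n))

theorem leftCreation_mem_toeplitzAlgebra (i : Fin n) : leftCreation i ∈ toeplitzAlgebra n := by
  rw [toeplitzAlgebra_eq_rightCommutant]
  exact leftCreation_mem_rightCommutant i

instance : CompleteSpace (MJ J) :=
  (Submodule.isClosed_topologicalClosure _).completeSpace_coe

variable {J}

theorem apply_mem_MJ {f : toeplitzAlgebra n} (hf : f ∈ J) (η : Fock n) :
    (f : Fock n →L[ℂ] Fock n) η ∈ MJ J :=
  Submodule.le_topologicalClosure _ (Submodule.subset_span ⟨f, hf, η, rfl⟩)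

/-- An operator that vanishes on `J F²(Hₙ)` vanishes on `M_J`. -/
theorem MJ_le_ker {E : Type*} [NormedAddCommGroup E] [NormedSpace ℂ E] {A : Fock n →L[ℂ] E}
    (hA : ∀ f ∈ J, ∀ η, A ((f : Fock n →L[ℂ] Fock n) η) = 0) {ξ : Fock n} (hξ : ξ ∈ MJ J) :
    A ξ = 0 := by
  have hle : MJ J ≤ LinearMap.ker A.toLinearMap := by
    refine Submodule.topologicalClosure_minimal _ (Submodule.span_le.2 ?_) A.isClosed_ker
    rintro _ ⟨f, hf, η, rfl⟩
    exact hA f hf η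
  exact hle hξ

theorem projNJ_eq_zero {ξ : Fock n} (hξ : ξ ∈ MJ J) : projNJ J ξ = 0 :=
  Submodule.orthogonalProjectionOnto_orthogonal_apply_eq_zero hξ

theorem sub_projNJ_mem (ξ : Fock n) : ξ - projNJ J ξ ∈ MJ J := by
  have h : ξ - projNJ J ξ ∈ (MJ J)ᗮᗮ :=
    Submodule.sub_starProjection_mem_orthogonal (K := NJ J) ξ
  rwa [Submodule.orthogonal_orthogonal] at h

theorem projNJ_coe (x : NJ J) : projNJ J x = x :=
  Submodule.orthogonalProjectionOnto_mem_subspace_eq_self x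

theorem inner_projNJ (ξ : Fock n) (x : NJ J) : ⟪projNJ J ξ, x⟫_ℂ = ⟪ξ, (x : Fock n)⟫_ℂ :=
  Submodule.inner_orthogonalProjectionOnto_eq_of_mem_right x ξ

theorem projNJ_adjoint : (projNJ J).adjoint = (NJ J).subtypeL := by
  ext1 x
  refine ext_inner_left ℂ fun ξ => ?_
  rw [ContinuousLinearMap.adjoint_inner_right, inner_projNJ]
  rfl

variable (J) in
/-- The compression `P_{N_J} A |_{N_J}`. -/
noncomputable def compression (A : Fock n →L[ℂ] Fock n) : NJ J →L[ℂ] NJ J :=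
  projNJ J ∘L A ∘L (NJ J).subtypeL

/-- The left creation operators preserve `J F²(Hₙ)`, because `J` is a left ideal. -/
theorem leftCreation_apply_mem (i : Fin n) {f : toeplitzAlgebra n} (hf : f ∈ J) (η : Fock n) :
    leftCreation i ((f : Fock n →L[ℂ] Fock n) η) ∈ MJ J :=
  apply_mem_MJ (J.mul_mem_left ⟨leftCreation i, leftCreation_mem_toeplitzAlgebra i⟩ f hf) η

/-- The right creation operators preserve `J F²(Hₙ)`, because they commute with `J`. -/
theorem rightCreation_apply_mem (i : Fin n) {f : toeplitzAlgebra n} (hf : f ∈ J) (η : Fock n) :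
    rightCreation i ((f : Fock n →L[ℂ] Fock n) η) ∈ MJ J := by
  have hf' : (f : Fock n →L[ℂ] Fock n) ∈ rightCommutant n :=
    toeplitzAlgebra_eq_rightCommutant (n := n) ▸ f.2
  rw [← mem_rightCommutant.1 hf']
  exact apply_mem_MJ hf _

/-- If `A` maps `J F²(Hₙ)` into `M_J`, then its compression satisfies `P A = (P A |_{N_J}) P`. -/
theorem compression_projNJ {A : Fock n →L[ℂ] Fock n}
    (hA : ∀ f ∈ J, ∀ η, A ((f : Fock n →L[ℂ] Fock n) η) ∈ MJ J) (ξ : Fock n) :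
    compression J A (projNJ J ξ) = projNJ J (A ξ) := by
  have h := MJ_le_ker (A := projNJ J ∘L A) (fun f hf η => projNJ_eq_zero (hA f hf η))
    (sub_projNJ_mem (J := J) ξ)
  rw [map_sub, sub_eq_zero] at h
  exact h.symm

theorem coe_compression_adjoint {A : Fock n →L[ℂ] Fock n}
    (hA : ∀ f ∈ J, ∀ η, A ((f : Fock n →L[ℂ] Fock n) η) ∈ MJ J) (x : NJ J) :
    ((compression J A).adjoint x : Fock n) = A.adjoint x := by
  refine ext_inner_left ℂ fun ξ => ?_
  rw [← inner_projNJ, ContinuousLinearMap.adjoint_inner_right, compression_projNJ hA,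
    inner_projNJ, ContinuousLinearMap.adjoint_inner_right]

theorem constrainedShift_eq (i : Fin n) :
    constrainedShift J i = compression J (leftCreation i) := rfl

theorem constrainedShift_projNJ (i : Fin n) (ξ : Fock n) :
    projNJ J (leftCreation i ξ) = constrainedShift J i (projNJ J ξ) :=
  (compression_projNJ (fun _ hf η => leftCreation_apply_mem i hf η) ξ).symm

theorem isRowContraction_constrainedShift : IsRowContraction (constrainedShift J) :=
  isRowContraction_of_sum_norm_sq_le fun x => by
    refine le_trans (Finset.sum_le_sum fun i _ => le_of_eq ?_)
      (isRowContraction_leftCreation.sum_norm_sq_le (x : Fock n))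
    rw [constrainedShift_eq,
      ← coe_compression_adjoint (fun _ hf η => leftCreation_apply_mem i hf η)]
    rfl

theorem compression_rightCreation_comm (i j : Fin n) :
    compression J (rightCreation i) * constrainedShift J j =
      constrainedShift J j * compression J (rightCreation i) := by
  ext1 x
  change compression J (rightCreation i) (projNJ J (leftCreation j x)) =
    constrainedShift J j (projNJ J (rightCreation i x))
  rw [compression_projNJ (fun _ hf η => rightCreation_apply_mem i hf η),
    ← constrainedShift_projNJ]
  exact congrArg (projNJ J) (congrArg (fun A : Fock n →L[ℂ] Fock n => A x)
    (rightCreation_comp_leftCreation i j))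

/-! ### The constrained algebra -/

theorem continuous_weakStar_inner {E : Type*} [NormedAddCommGroup E] [InnerProductSpace ℂ E]
    (x y : E) : Continuous[weakStarTopology E, _] fun A : E →L[ℂ] E => ⟪y, A x⟫_ℂ := by
  have h : (fun A : E →L[ℂ] E => ⟪y, A x⟫_ℂ) = fun A : E →L[ℂ] E =>
      ∑' j, ⟪(lp.single 2 (0 : ℕ) y : lp (fun _ : ℕ => E) 2) j,
        A ((lp.single 2 (0 : ℕ) x : lp (fun _ : ℕ => E) 2) j)⟫_ℂ := by
    funext A
    rw [tsum_eq_single 0 fun j hj => by simp [lp.single_apply, hj]]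
    simp
  rw [h]
  exact continuous_iInf_dom (continuous_iInf_dom continuous_induced_dom)

theorem isWeakStarClosed_setOf_comp_eq {E : Type*} [NormedAddCommGroup E] [InnerProductSpace ℂ E]
    [CompleteSpace E] (R : E →L[ℂ] E) : IsWeakStarClosed {A : E →L[ℂ] E | R * A = A * R} := by
  have h : {A : E →L[ℂ] E | R * A = A * R} =
      ⋂ x, ⋂ y, {A | ⟪R.adjoint y, A x⟫_ℂ = ⟪y, A (R x)⟫_ℂ} := by
    ext A
    simp only [Set.mem_ofPred_eq, Set.mem_iInter, ContinuousLinearMap.adjoint_inner_left]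
    refine ⟨fun h x y => congrArg (fun B : E →L[ℂ] E => ⟪y, B x⟫_ℂ) h, fun h => ?_⟩
    ext x
    exact ext_inner_left ℂ fun y => h x y
  rw [IsWeakStarClosed, h]
  exact @isClosed_iInter _ _ (weakStarTopology E) _ fun x =>
    @isClosed_iInter _ _ (weakStarTopology E) _ fun y =>
      @isClosed_eq ℂ (E →L[ℂ] E) _ (weakStarTopology E) _ _ _ (continuous_weakStar_inner _ _)
        (continuous_weakStar_inner _ _)

/-- `W(B₁, …, Bₙ)` lies in the commutant of the compressed right creation operators. -/
theorem comm_of_mem_constrainedAlgebra {X : NJ J →L[ℂ] NJ J} (hX : X ∈ constrainedAlgebra J)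
    (i : Fin n) : compression J (rightCreation i) * X = X * compression J (rightCreation i) := by
  have hle : constrainedAlgebra J ≤
      Subalgebra.centralizer ℂ (Set.range fun i => compression J (rightCreation i)) := by
    refine sInf_le ⟨fun j => ?_, ?_⟩
    · rw [Subalgebra.mem_centralizer_iff]
      rintro _ ⟨i, rfl⟩
      exact compression_rightCreation_comm i j
    · have h : (Subalgebra.centralizer ℂ (Set.range fun i => compression J (rightCreation i)) :
          Set (NJ J →L[ℂ] NJ J)) =
          ⋂ i, {A | compression J (rightCreation i) * A = A * compression J (rightCreation i)} := by
        ext A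
        simp [Set.mem_centralizer_iff]
      rw [h, IsWeakStarClosed]
      exact @isClosed_iInter _ _ (weakStarTopology _) _ fun i => isWeakStarClosed_setOf_comp_eq _
  exact (Subalgebra.mem_centralizer_iff ℂ).1 (hle hX) _ ⟨i, rfl⟩

/-- Every element of `W(B₁, …, Bₙ)` is the compression of an element of `Fₙ^∞`, by commutant
lifting. -/
theorem exists_toeplitz_of_mem_constrainedAlgebra {X : NJ J →L[ℂ] NJ J}
    (hX : X ∈ constrainedAlgebra J) :
    ∃ f ∈ toeplitzAlgebra n, ∀ ξ, projNJ J (f ξ) = X (projNJ J ξ) := by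
  have hR (i : Fin n) := fun f hf η => rightCreation_apply_mem (J := J) i (f := f) hf η
  obtain ⟨Y, hYR, hYX⟩ := exists_lift (NJ J).subtypeₗᵢ
    (fun i => (compression J (rightCreation i)).adjoint)
    (fun i h => coe_compression_adjoint (hR i) h) X.adjoint (fun i h => by
      have h1 := congrArg ContinuousLinearMap.adjoint (comm_of_mem_constrainedAlgebra hX i)
      rw [ContinuousLinearMap.mul_def, ContinuousLinearMap.mul_def,
        ContinuousLinearMap.adjoint_comp, ContinuousLinearMap.adjoint_comp] at h1
      exact congrArg (fun A : NJ J →L[ℂ] NJ J => A h) h1)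
  refine ⟨Y.adjoint, ?_, fun ξ => ?_⟩
  · rw [toeplitzAlgebra_eq_rightCommutant, mem_rightCommutant]
    intro i h
    refine ext_inner_left ℂ fun ξ => ?_
    rw [ContinuousLinearMap.adjoint_inner_right, ← ContinuousLinearMap.adjoint_inner_left, hYR,
      ← ContinuousLinearMap.adjoint_inner_left, ContinuousLinearMap.adjoint_inner_right]
  · refine ext_inner_right ℂ fun x => ?_
    rw [inner_projNJ, ContinuousLinearMap.adjoint_inner_left,
      ← ContinuousLinearMap.adjoint_inner_right, inner_projNJ]
    exact congrArg (fun η : Fock n => ⟪ξ, η⟫_ℂ) (hYX x)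

/-- Every element of `W(B₁, …, Bₙ)` is `f(B₁, …, Bₙ)` for some `f` in `Fₙ^∞`. -/
theorem exists_hasFunctionalCalculus_constrainedShift {X : NJ J →L[ℂ] NJ J}
    (hX : X ∈ constrainedAlgebra J) :
    ∃ f ∈ toeplitzAlgebra n, HasFunctionalCalculus (constrainedShift J) f X := by
  obtain ⟨f, hf, hfX⟩ := exists_toeplitz_of_mem_constrainedAlgebra hX
  refine ⟨f, hf, fun r hr => isRowContraction_constrainedShift.summable_radialTerm f hr,
    fun x => ?_⟩
  rw [toeplitzAlgebra_eq_rightCommutant] at hf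
  have h1 := ((projNJ J).continuous.tendsto _).comp
    ((hasFunctionalCalculus_leftCreation hf).2 (x : Fock n))
  rw [hfX, projNJ_coe] at h1
  refine h1.congr' (eventually_mem_Ioo.mono fun r hr => ?_)
  have h2 := map_tsum_radialTerm (L := projNJ J) (fun i ξ => constrainedShift_projNJ i ξ)
    (isRowContraction_leftCreation.summable_radialTerm f hr)
    (isRowContraction_constrainedShift.summable_radialTerm f hr) (x : Fock n)
  rwa [projNJ_coe] at h2

end Compression

/-! ### The constrained Poisson kernel -/

section ConstrainedPoisson

variable {n : ℕ} {H : Type*} [NormedAddCommGroup H] [InnerProductSpace ℂ H] [CompleteSpace H]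
  {J : TwoSidedIdeal (toeplitzAlgebra n)} {T : Fin n → H →L[ℂ] H}

/-- An operator that intertwines the left creation operators with a row contraction intertwines
their functional calculi. -/
theorem map_of_hasFunctionalCalculus (hT : IsRowContraction T) {L : Fock n →L[ℂ] H}
    (hL : ∀ i ξ, L (leftCreation i ξ) = T i (L ξ)) {f : Fock n →L[ℂ] Fock n}
    (hf : f ∈ toeplitzAlgebra n) {A : H →L[ℂ] H} (hA : HasFunctionalCalculus T f A) (η : Fock n) :
    L (f η) = A (L η) := by
  rw [toeplitzAlgebra_eq_rightCommutant] at hf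
  have h1 := (L.continuous.tendsto _).comp ((hasFunctionalCalculus_leftCreation hf).2 η)
  refine tendsto_nhds_unique h1 ((hA.2 (L η)).congr' (eventually_mem_Ioo.mono fun r hr => ?_))
  exact (map_tsum_radialTerm hL (isRowContraction_leftCreation.summable_radialTerm f hr)
    (hT.summable_radialTerm f hr) η).symm

/-- If `φ(T) = 0` for all `φ ∈ J`, then `K_T*` vanishes on `M_J ⊗ D`. -/
theorem poissonKernel_adjoint_tmulH_eq_zero (hT : IsRowContraction T)
    (hJT : ∀ φ : toeplitzAlgebra n, φ ∈ J →
      HasFunctionalCalculus T (φ : Fock n →L[ℂ] Fock n) 0)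
    {ξ : Fock n} (hξ : ξ ∈ MJ J) (d : defectSpace T) :
    (poissonKernel T hT).adjoint (tmulH ξ d) = 0 := by
  refine MJ_le_ker (A := (poissonKernel T hT).adjoint ∘L tmulRight (Fock n) d)
    (fun f hf η => ?_) hξ
  exact (map_of_hasFunctionalCalculus hT (L := (poissonKernel T hT).adjoint ∘L
    tmulRight (Fock n) d) (fun i ξ => poissonKernel_adjoint_leftCreation hT i ξ d) f.2
    (hJT f hf) η).trans rfl

theorem constrainedKernel_adjoint_tmulH (hT : IsRowContraction T) (x : NJ J)
    (d : defectSpace T) :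
    (constrainedKernel J T hT).adjoint (tmulH x d) =
      (poissonKernel T hT).adjoint (tmulH (x : Fock n) d) := by
  rw [constrainedKernel, ContinuousLinearMap.adjoint_comp, tensorId_adjoint, projNJ_adjoint,
    ContinuousLinearMap.comp_apply, tensorId_tmulH]
  rfl

theorem constrainedKernel_adjoint_projNJ (hT : IsRowContraction T)
    (hJT : ∀ φ : toeplitzAlgebra n, φ ∈ J →
      HasFunctionalCalculus T (φ : Fock n →L[ℂ] Fock n) 0) (ξ : Fock n) (d : defectSpace T) :
    (constrainedKernel J T hT).adjoint (tmulH (projNJ J ξ) d) =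
      (poissonKernel T hT).adjoint (tmulH ξ d) := by
  have h := poissonKernel_adjoint_tmulH_eq_zero hT hJT (sub_projNJ_mem (J := J) ξ) d
  rw [← tmulRight_apply, map_sub, map_sub, sub_eq_zero] at h
  rw [constrainedKernel_adjoint_tmulH]
  exact h.symm

theorem constrainedKernel_adjoint_constrainedShift (hT : IsRowContraction T)
    (hJT : ∀ φ : toeplitzAlgebra n, φ ∈ J →
      HasFunctionalCalculus T (φ : Fock n →L[ℂ] Fock n) 0) (i : Fin n) (x : NJ J)
    (d : defectSpace T) :
    (constrainedKernel J T hT).adjoint (tmulH (constrainedShift J i x) d) =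
      T i ((constrainedKernel J T hT).adjoint (tmulH x d)) := by
  rw [constrainedKernel_adjoint_tmulH hT x, ← poissonKernel_adjoint_leftCreation,
    ← constrainedKernel_adjoint_projNJ hT hJT, constrainedShift_projNJ, projNJ_coe]

theorem constrainedKernel_comp_adjoint (hT : IsRowContraction T)
    (hJT : ∀ φ : toeplitzAlgebra n, φ ∈ J →
      HasFunctionalCalculus T (φ : Fock n →L[ℂ] Fock n) 0) (i : Fin n) :
    constrainedKernel J T hT ∘L (T i).adjoint =
      tensorId (defectSpace T) (constrainedShift J i).adjoint ∘L constrainedKernel J T hT := by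
  have h : (constrainedKernel J T hT).adjoint ∘L tensorId (defectSpace T) (constrainedShift J i) =
      T i ∘L (constrainedKernel J T hT).adjoint := by
    refine ext_tmulH fun x d => ?_
    rw [ContinuousLinearMap.comp_apply, tensorId_tmulH]
    exact constrainedKernel_adjoint_constrainedShift hT hJT i x d
  have h' := congrArg ContinuousLinearMap.adjoint h
  rw [ContinuousLinearMap.adjoint_comp, ContinuousLinearMap.adjoint_comp,
    ContinuousLinearMap.adjoint_adjoint, tensorId_adjoint] at h'
  exact h'.symm

theorem constrainedKernel_adjoint_comp_self (hT : IsRowContraction T)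
    (hJT : ∀ φ : toeplitzAlgebra n, φ ∈ J →
      HasFunctionalCalculus T (φ : Fock n →L[ℂ] Fock n) 0) :
    (constrainedKernel J T hT).adjoint ∘L constrainedKernel J T hT =
      (poissonKernel T hT).adjoint ∘L poissonKernel T hT := by
  have h : (constrainedKernel J T hT).adjoint ∘L tensorId (defectSpace T) (projNJ J) =
      (poissonKernel T hT).adjoint := by
    refine ext_tmulH fun ξ d => ?_
    rw [ContinuousLinearMap.comp_apply, tensorId_tmulH]
    exact constrainedKernel_adjoint_projNJ hT hJT ξ d
  conv_lhs => rw [constrainedKernel.eq_def J T hT]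
  rw [← ContinuousLinearMap.comp_assoc, ← constrainedKernel.eq_def, h]

theorem constrainedKernel_injective (hT : IsRowContraction T) (hT_cnc : IsCNC T)
    (hJT : ∀ φ : toeplitzAlgebra n, φ ∈ J →
      HasFunctionalCalculus T (φ : Fock n →L[ℂ] Fock n) 0) :
    Function.Injective (constrainedKernel J T hT) := by
  refine (injective_iff_map_eq_zero _).2 fun h hh => hT_cnc.eq_zero_of_poissonKernel_eq_zero hT ?_
  have h1 := congrArg (fun A : H →L[ℂ] H => A h) (constrainedKernel_adjoint_comp_self hT hJT)
  simp only [ContinuousLinearMap.comp_apply, hh, map_zero] at h1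
  rw [← inner_self_eq_zero (𝕜 := ℂ), ← ContinuousLinearMap.adjoint_inner_right, ← h1,
    inner_zero_right]

/-- The functional calculus of `T` exists for every `f` for which `f(B) = X`, and is determined by
`f(T) K* = K* (X ⊗ I)`: the radial means of `f(T)` are bounded by `‖f‖`, and they converge on the
range of `K*`, which is dense because `K` is injective. -/
theorem hasFunctionalCalculus_of_constrainedShift (hT : IsRowContraction T) (hT_cnc : IsCNC T)
    (hJT : ∀ φ : toeplitzAlgebra n, φ ∈ J →
      HasFunctionalCalculus T (φ : Fock n →L[ℂ] Fock n) 0)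
    {f : Fock n →L[ℂ] Fock n} (hf : f ∈ toeplitzAlgebra n) {X : NJ J →L[ℂ] NJ J}
    (hfX : HasFunctionalCalculus (constrainedShift J) f X) {A : H →L[ℂ] H}
    (hA : A ∘L (constrainedKernel J T hT).adjoint =
      (constrainedKernel J T hT).adjoint ∘L tensorId (defectSpace T) X) :
    HasFunctionalCalculus T f A := by
  rw [toeplitzAlgebra_eq_rightCommutant] at hf
  refine ⟨fun r hr => hT.summable_radialTerm f hr, ?_⟩
  refine tendsto_apply_of_total (C := ‖f‖)
    (eventually_mem_Ioo.mono fun r hr => hT.norm_tsum_radialTerm_le hf hr) A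
    (s := {y | ∃ (x : NJ J) (d : defectSpace T),
      y = (constrainedKernel J T hT).adjoint (tmulH x d)}) (fun h hh => ?_) ?_
  · refine constrainedKernel_injective hT hT_cnc hJT ?_
    rw [map_zero]
    refine eq_zero_of_forall_inner_tmulH fun x d => ?_
    rw [← ContinuousLinearMap.adjoint_inner_left]
    exact hh _ ⟨x, d, rfl⟩
  · rintro _ ⟨x, d, rfl⟩
    have h1 := congrArg (fun B : HilbertTensor (NJ J) (defectSpace T) →L[ℂ] H => B (tmulH x d)) hA
    simp only [ContinuousLinearMap.comp_apply, tensorId_tmulH] at h1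
    rw [h1]
    obtain ⟨L, hL⟩ : ∃ L : NJ J →L[ℂ] H,
        ∀ x, L x = (constrainedKernel J T hT).adjoint (tmulH x d) :=
      ⟨(constrainedKernel J T hT).adjoint ∘L tmulRight (NJ J) d, fun _ => rfl⟩
    simp only [← hL]
    refine ((L.continuous.tendsto _).comp (hfX.2 x)).congr'
      (eventually_mem_Ioo.mono fun r hr => ?_)
    refine map_tsum_radialTerm (fun i y => ?_) (hfX.1 r hr) (hT.summable_radialTerm f hr) x
    rw [hL, hL, constrainedKernel_adjoint_constrainedShift hT hJT]

end ConstrainedPoisson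

end NCVariety

theorem corollary1p2 {n : ℕ} (hn : 1 ≤ n)
    {H : Type*} [NormedAddCommGroup H] [InnerProductSpace ℂ H] [CompleteSpace H]
    (J : TwoSidedIdeal (toeplitzAlgebra n)) (hJ : J ≠ ⊤) (hJ_closed : IsWOTClosedIdeal J)
    (T : Fin n → H →L[ℂ] H) (hT : IsRowContraction T) (hT_cnc : IsCNC T)
    (hJT : ∀ φ : toeplitzAlgebra n, φ ∈ J →
      HasFunctionalCalculus T (φ : Fock n →L[ℂ] Fock n) 0) :
    (∀ i : Fin n,
      constrainedKernel J T hT ∘L (T i).adjoint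
        = tensorId (defectSpace T) (constrainedShift J i).adjoint ∘L constrainedKernel J T hT) ∧
    (∃ Q : H →L[ℂ] H,
      TendstoSOT (fun k : ℕ => ∑ α : Fin k → Fin n,
        wordOp T (List.ofFn α) ∘L (wordOp T (List.ofFn α)).adjoint) atTop Q ∧
      (constrainedKernel J T hT).adjoint ∘L constrainedKernel J T hT
        = ContinuousLinearMap.id ℂ H - Q) ∧
    Function.Injective (constrainedKernel J T hT) ∧
    (∀ Ψ : constrainedAlgebra J → (H →L[ℂ] H),
      (∀ X : constrainedAlgebra J,
        Ψ X ∘L (constrainedKernel J T hT).adjoint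
          = (constrainedKernel J T hT).adjoint
              ∘L tensorId (defectSpace T) (X : NJ J →L[ℂ] NJ J)) →
      ∀ X : constrainedAlgebra J,
        (∃ f : toeplitzAlgebra n,
          HasFunctionalCalculus (constrainedShift J) (f : Fock n →L[ℂ] Fock n) X) ∧
        ∀ f : toeplitzAlgebra n,
          HasFunctionalCalculus (constrainedShift J) (f : Fock n →L[ℂ] Fock n) X →
          HasFunctionalCalculus T (f : Fock n →L[ℂ] Fock n) (Ψ X)) := by
  refine ⟨constrainedKernel_comp_adjoint hT hJT, ⟨_, tendstoSOT_sum_wordOp hT, ?_⟩,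
    constrainedKernel_injective hT hT_cnc hJT, fun Ψ hΨ X => ⟨?_, fun f hfX => ?_⟩⟩
  · rw [constrainedKernel_adjoint_comp_self hT hJT, sub_sub_cancel]
  · obtain ⟨f, hf, hfX⟩ := exists_hasFunctionalCalculus_constrainedShift X.2
    exact ⟨⟨f, hf⟩, hfX⟩
  · exact hasFunctionalCalculus_of_constrainedShift hT hT_cnc hJT f.2 hfX (hΨ X)
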